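/- Use coordinates $(t,R,\vartheta,\varphi)$ and, for $a\in\mathbb R$ and a function $M(R)$, put $\Sigma=R^2+a^2\cos^2\vartheta$, $\Delta=R^2-2RM(R)+a^2$. The Kerrr metric is $$ds^2=\Big(1-\tfrac{2RM}{\Sigma}\Big)dt^2+\tfrac{4aRM}{\Sigma}\sin^2\vartheta\,dt\,d\varphi-\tfrac{\Sigma}{\Delta}dR^2-\Sigma\,d\vartheta^2-\tfrac{\sin^2\vartheta}{\Sigma}\big[(R^2+a^2)^2-a^2\sin^2\vartheta\,\Delta\big]d\varphi^2 .$$ For a function $\rho_G(R)$ consider the energy-momentum tensor $$T^\mu{}_\nu=(\rho+p_\vartheta)(u^\mu u_\nu-\ell^\mu\ell_\nu)-p_\vartheta\delta^\mu_\nu,\qquad u^\mu=\sqrt{-g^{RR}}\,\big(\delta^\mu_t+\Omega\,\delta^\mu_\varphi\big),\quad \Omega=\frac{a}{R^2+a^2},\quad \ell^\mu=-\frac{1}{\sqrt{-g_{RR}}}\,\delta^\mu_R,$$ $$\rho=\frac{R^4}{\Sigma^2}\,\rho_G(R),\qquad \rho+p_\vartheta=-\frac{\Sigma}{2R}\,\partial_R\rho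 .$$ Let $G_{\mu\nu}=R_{\mu\nu}-\frac12 g_{\mu\nu}g^{\alpha\beta}R_{\alpha\beta}$ be the Einstein tensor, in the sign convention $R_{\mu\nu}=\partial_\nu\Gamma^\lambda_{\mu\lambda}-\partial_\lambda\Gamma^\lambda_{\mu\nu}+\Gamma^\sigma_{\mu\lambda}\Gamma^\lambda_{\nu\sigma}-\Gamma^\sigma_{\mu\nu}\Gamma^\lambda_{\lambda\sigma}$, and consider the two equations $$G_{tt}=-8\pi T_{tt},\qquad G_{RR}=-8\pi T_{RR}.\tag{$*$}$$ (A) Let $I\subseteq(0,\infty)$ be open, $M$ of class $C^2$ on $I$, $\rho_G$ differentiable on $I$, and $\Delta>0$ on $I$. (i) If $\vartheta\in(0,\pi)$ and $(*)$ holds at all points $(t,R,\vartheta,\varphi)$ with $R\in I$, then for all $R\in I$ $$\rho_G'(R)+\frac{4a^2\cos^2\vartheta}{R\,\Sigma}\,\rho_G(R)=0 .$$ (ii) Consequently, if $a\ne0$ and $\rho_G$ is not identically zero on $I$, then for no nonempty open $J\subseteq(0,\pi)$ does $(*)$ hold at all points with $R\in I$, $\vartheta\in J$. (B) Let $\rho_G(R)=\frac{m}{8\pi^{3/2}\ell_0^3}e^{-R^2/4\ell_0^2}$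 with $m,\ell_0>0$, and let $a\in\mathbb R$ be arbitrary. If $I\subseteq(0,\infty)$ and $J\subseteq(0,\pi)$ are nonempty and open, $M$ is of class $C^2$ on $I$ and $\Delta>0$ on $I$, then $(*)$ does not hold at all points with $R\in I$, $\vartheta\in J$. In particular, for $M(R)=4\pi\int_0^R x^2\rho_G(x)\,dx$ the Kerrr metric does not satisfy $(*)$ at all points with $R>0$, $0<\vartheta<\pi$ and $\Delta(R)>0$. -/

import Mathlib

noncomputable section

namespace Kerrr

/-- Points of the coordinate chart; the components are
`x 0 = t`, `x 1 = R`, `x 2 = ϑ`, `x 3 = φ`. -/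
abbrev Coords : Type := Fin 4 → ℝ

/-! ### Coordinate tensor calculus for an arbitrary metric -/

/-- The partial derivative of `f` with respect to the `i`-th coordinate at `x`. -/
def pd (i : Fin 4) (f : Coords → ℝ) (x : Coords) : ℝ :=
  deriv (fun s : ℝ => f (Function.update x i s)) (x i)

/-- Christoffel symbols `Γ^l_{mn}` of the Levi-Civita connection of `g`. -/
def christoffel (g : Coords → Matrix (Fin 4) (Fin 4) ℝ) (l m n : Fin 4) (x : Coords) : ℝ :=
  (1 / 2) * ∑ s, (g x)⁻¹ l s *
    (pd n (fun y => g y s m) x + pd m (fun y => g y s n) x - pd s (fun y => g y m n) x)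

/-- Ricci tensor, in the sign convention for which the field equations of gravity
read `G = -8πT`:
`R_{mn} = ∂_n Γ^l_{ml} - ∂_l Γ^l_{mn} + Γ^s_{ml} Γ^l_{ns} - Γ^s_{mn} Γ^l_{ls}`. -/
def ricci (g : Coords → Matrix (Fin 4) (Fin 4) ℝ) (m n : Fin 4) (x : Coords) : ℝ :=
  (∑ l, (pd n (christoffel g l m l) x - pd l (christoffel g l m n) x)) +
    ∑ l, ∑ s, (christoffel g s m l x * christoffel g l n s x -
      christoffel g s m n x * christoffel g l l s x)

/-- The curvature scalar `g^{mn} R_{mn}`. -/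
def scalarCurvature (g : Coords → Matrix (Fin 4) (Fin 4) ℝ) (x : Coords) : ℝ :=
  ∑ m, ∑ n, (g x)⁻¹ m n * ricci g m n x

/-- The Einstein tensor `G_{mn} = R_{mn} - (1/2) (g^{pq} R_{pq}) g_{mn}`. -/
def einstein (g : Coords → Matrix (Fin 4) (Fin 4) ℝ) (m n : Fin 4) (x : Coords) : ℝ :=
  ricci g m n x - (1 / 2) * scalarCurvature g x * g x m n

/-- Lowering of the index of a vector, `v_m = g_{mn} v^n`. -/
def lower (g : Matrix (Fin 4) (Fin 4) ℝ) (v : Fin 4 → ℝ) (m : Fin 4) : ℝ :=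
  ∑ n, g m n * v n

/-! ### The metric -/

/-- `Σ = R² + a² cos² ϑ`. -/
def Sig (a R θ : ℝ) : ℝ := R ^ 2 + a ^ 2 * Real.cos θ ^ 2

/-- `Δ = R² - 2 R M(R) + a²`. -/
def Del (a : ℝ) (M : ℝ → ℝ) (R : ℝ) : ℝ := R ^ 2 - 2 * R * M R + a ^ 2

/-- The Kerrr metric `g_{μν}` with rotation parameter `a` and mass function `M`, of signature
`(+,-,-,-)`. The line element contains `2 g_{tφ} dt dφ`. -/
def metric (a : ℝ) (M : ℝ → ℝ) (x : Coords) : Matrix (Fin 4) (Fin 4) ℝ :=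
  let R := x 1
  let θ := x 2
  let S := Sig a R θ
  let D := Del a M R
  !![1 - 2 * R * M R / S, 0, 0, 2 * a * R * M R / S * Real.sin θ ^ 2;
     0, -(S / D), 0, 0;
     0, 0, -S, 0;
     2 * a * R * M R / S * Real.sin θ ^ 2, 0, 0,
       -(Real.sin θ ^ 2 / S * ((R ^ 2 + a ^ 2) ^ 2 - a ^ 2 * Real.sin θ ^ 2 * D))]

/-! ### The anisotropic fluid -/

/-- The angular velocity `Ω = a / (R² + a²)`. -/
def Om (a R : ℝ) : ℝ := a / (R ^ 2 + a ^ 2)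

/-- The four-velocity `u^μ = √(-g^{RR}) (δ^μ_t + Ω δ^μ_φ)`. -/
def fourVelocity (a : ℝ) (M : ℝ → ℝ) (x : Coords) : Fin 4 → ℝ :=
  Real.sqrt (-(metric a M x)⁻¹ 1 1) • (Pi.single 0 1 + Om a (x 1) • Pi.single 3 1)

/-- The radial vector `ℓ^μ = -(1/√(-g_{RR})) δ^μ_R`. -/
def radialVector (a : ℝ) (M : ℝ → ℝ) (x : Coords) : Fin 4 → ℝ :=
  (-(1 / Real.sqrt (-(metric a M x 1 1)))) • Pi.single 1 1

/-- The density `ρ = (R⁴/Σ²) ρ_G(R)`. -/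
def density (a : ℝ) (ρG : ℝ → ℝ) (x : Coords) : ℝ :=
  x 1 ^ 4 / Sig a (x 1) (x 2) ^ 2 * ρG (x 1)

/-- The tangential pressure `p_ϑ`, given by `ρ + p_ϑ = -(Σ/(2R)) ∂_R ρ`. -/
def tangentialPressure (a : ℝ) (ρG : ℝ → ℝ) (x : Coords) : ℝ :=
  -(Sig a (x 1) (x 2) / (2 * x 1)) * pd 1 (density a ρG) x - density a ρG x

/-- The mixed energy-momentum tensor
`T^μ_ν = (ρ + p_ϑ)(u^μ u_ν - ℓ^μ ℓ_ν) - p_ϑ δ^μ_ν`. -/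
def stressMixed (a : ℝ) (M ρG : ℝ → ℝ) (m n : Fin 4) (x : Coords) : ℝ :=
  let u := fourVelocity a M x
  let l := radialVector a M x
  let g := metric a M x
  (density a ρG x + tangentialPressure a ρG x) * (u m * lower g u n - l m * lower g l n) -
    tangentialPressure a ρG x * (if m = n then 1 else 0)

/-- The covariant energy-momentum tensor `T_{μν} = g_{μα} T^α_ν`. -/
def stress (a : ℝ) (M ρG : ℝ → ℝ) (m n : Fin 4) (x : Coords) : ℝ :=
  ∑ k, metric a M x m k * stressMixed a M ρG k n x

/-- The two field equations `G_{tt} = -8π T_{tt}` and `G_{RR} = -8π T_{RR}` at the point `x`. -/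
def FieldEqs (a : ℝ) (M ρG : ℝ → ℝ) (x : Coords) : Prop :=
  einstein (metric a M) 0 0 x = -8 * Real.pi * stress a M ρG 0 0 x ∧
    einstein (metric a M) 1 1 x = -8 * Real.pi * stress a M ρG 1 1 x

/-- The Gaussian profile `ρ_G(R) = m / (8 π^{3/2} ℓ₀³) · exp(-R²/(4ℓ₀²))`. -/
def gaussianDensity (m l0 R : ℝ) : ℝ :=
  m / (8 * Real.pi ^ (3 / 2 : ℝ) * l0 ^ 3) * Real.exp (-(R ^ 2) / (4 * l0 ^ 2))

/-- The mass function of the Kerrr metric, `M(R) = 4π ∫₀^R x² ρ_G(x) dx`. -/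
def kerrrMass (m l0 R : ℝ) : ℝ :=
  4 * Real.pi * ∫ x in (0 : ℝ)..R, x ^ 2 * gaussianDensity m l0 x

end Kerrr

end

/-! Write `F = 2RM` and `A = R² + a²`. In the Carter coframe the metric is `(Δ/Σ)(dt - a sin²ϑ dφ)²
- (Σ/Δ)dR² - Σ dϑ² - (sin²ϑ/Σ)(a dt - A dφ)²`. The Ricci tensor is diagonal there: it equals `-prs`
times the metric on the first two directions and `enr` times the metric on the last two, so the
Einstein tensor has the corresponding factors `-enr` and `prs`. This is established by computing the
Christoffel symbols in closed form (`christoffel_kerr`) and then the Ricci components (`ricci_tt` to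
`ricci_θθ`).

The `RR` equation says `enr = 8πρ`, that is `M' = 4πR²ρ_G`. Differentiating this gives `prs =
8πp_ϑ`, so the density and both pressures agree with the fluid. What does not agree is the
four-velocity: `u` has square norm `Δ²/A²` instead of `1`. The `tt` equation therefore reduces to
`(ρ + p_ϑ)(Δ² - A²) = 0`. Since `ρ + p_ϑ` is a nonzero multiple of `transport`, at each `R` either
`transport` vanishes or `Δ = A`, that is `M = 0`.

The second alternative adds nothing (`transport_eq_zero`): if `transport` were nonzero at a point,
then by continuity it would be nonzero nearby, so `M`, hence `M'`, hence `ρ_G` would vanish nearby,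
and `transport` with them.

For `a ≠ 0` and `R > 0` the coefficient of `ρ_G` in `transport` is injective in `cos²ϑ`, so two
angles force `ρ_G = 0`. For the Gaussian a single angle is enough: `transport = 0` becomes an
equation whose left side is strictly increasing in `R` and whose right side is constant. -/

noncomputable section

namespace Kerrr

open Real

/-! ### Block matrices for tensors of a circular metric -/

/-- A symmetric matrix that does not mix the index pairs `(t, φ)` and `(R, ϑ)`. -/
def blk (p q u d v w : ℝ) : Matrix (Fin 4) (Fin 4) ℝ :=
  !![p, 0, 0, q; 0, u, d, 0; 0, d, v, 0; q, 0, 0, w]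

/-- A symmetric matrix that only mixes the index pairs `(t, φ)` and `(R, ϑ)`. -/
def off (x y z w : ℝ) : Matrix (Fin 4) (Fin 4) ℝ :=
  !![0, x, y, 0; x, 0, 0, z; y, 0, 0, w; 0, z, w, 0]

theorem blk_apply (p q u d v w : ℝ) :
    blk p q u d v w 0 0 = p ∧ blk p q u d v w 0 1 = 0 ∧ blk p q u d v w 0 2 = 0 ∧
      blk p q u d v w 0 3 = q ∧
    blk p q u d v w 1 0 = 0 ∧ blk p q u d v w 1 1 = u ∧ blk p q u d v w 1 2 = d ∧
      blk p q u d v w 1 3 = 0 ∧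
    blk p q u d v w 2 0 = 0 ∧ blk p q u d v w 2 1 = d ∧ blk p q u d v w 2 2 = v ∧
      blk p q u d v w 2 3 = 0 ∧
    blk p q u d v w 3 0 = q ∧ blk p q u d v w 3 1 = 0 ∧ blk p q u d v w 3 2 = 0 ∧
      blk p q u d v w 3 3 = w :=
  ⟨rfl, rfl, rfl, rfl, rfl, rfl, rfl, rfl, rfl, rfl, rfl, rfl, rfl, rfl, rfl, rfl⟩

theorem off_apply (x y z w : ℝ) :
    off x y z w 0 0 = 0 ∧ off x y z w 0 1 = x ∧ off x y z w 0 2 = y ∧ off x y z w 0 3 = 0 ∧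
    off x y z w 1 0 = x ∧ off x y z w 1 1 = 0 ∧ off x y z w 1 2 = 0 ∧ off x y z w 1 3 = z ∧
    off x y z w 2 0 = y ∧ off x y z w 2 1 = 0 ∧ off x y z w 2 2 = 0 ∧ off x y z w 2 3 = w ∧
    off x y z w 3 0 = 0 ∧ off x y z w 3 1 = z ∧ off x y z w 3 2 = w ∧ off x y z w 3 3 = 0 :=
  ⟨rfl, rfl, rfl, rfl, rfl, rfl, rfl, rfl, rfl, rfl, rfl, rfl, rfl, rfl, rfl, rfl⟩

theorem vec4_apply {α : Type*} (X Y Z W : α) :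
    ![X, Y, Z, W] 0 = X ∧ ![X, Y, Z, W] 1 = Y ∧ ![X, Y, Z, W] 2 = Z ∧ ![X, Y, Z, W] 3 = W :=
  ⟨rfl, rfl, rfl, rfl⟩

/-! ### The metric, its inverse and its first derivatives -/

/-- The components of the Kerrr metric, as functions of `a`, `R`, `c = cos ϑ` and `F = 2RM`. -/
def kg (a R c F : ℝ) : Matrix (Fin 4) (Fin 4) ℝ :=
  blk (1 - F / (R ^ 2 + a ^ 2 * c ^ 2))
    (a * (1 - c ^ 2) * (F / (R ^ 2 + a ^ 2 * c ^ 2)))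
    (-((R ^ 2 + a ^ 2 * c ^ 2) / (R ^ 2 + a ^ 2 - F)))
    0
    (-(R ^ 2 + a ^ 2 * c ^ 2))
    (-((1 - c ^ 2) / (R ^ 2 + a ^ 2 * c ^ 2) *
      ((R ^ 2 + a ^ 2) ^ 2 - a ^ 2 * (1 - c ^ 2) * (R ^ 2 + a ^ 2 - F))))

/-- The inverse of the metric `kg`. -/
def kgInv (a R c F : ℝ) : Matrix (Fin 4) (Fin 4) ℝ :=
  blk (((R ^ 2 + a ^ 2) ^ 2 - a ^ 2 * (1 - c ^ 2) * (R ^ 2 + a ^ 2 - F)) /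
      ((R ^ 2 + a ^ 2 * c ^ 2) * (R ^ 2 + a ^ 2 - F)))
    (a * F / ((R ^ 2 + a ^ 2 * c ^ 2) * (R ^ 2 + a ^ 2 - F)))
    (-((R ^ 2 + a ^ 2 - F) / (R ^ 2 + a ^ 2 * c ^ 2)))
    0
    (-(1 / (R ^ 2 + a ^ 2 * c ^ 2)))
    (-((R ^ 2 + a ^ 2 - F - a ^ 2 * (1 - c ^ 2)) /
      ((R ^ 2 + a ^ 2 * c ^ 2) * (R ^ 2 + a ^ 2 - F) * (1 - c ^ 2))))

theorem blk_inv {p q u v w p' q' w' : ℝ} (hu : u ≠ 0) (hv : v ≠ 0) (h1 : p * p' + q * q' = 1)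
    (h2 : p * q' + q * w' = 0) (h3 : q * p' + w * q' = 0) (h4 : q * q' + w * w' = 1) :
    (blk p q u 0 v w)⁻¹ = blk p' q' u⁻¹ 0 v⁻¹ w' := by
  apply Matrix.inv_eq_right_inv
  ext i j
  fin_cases i <;> fin_cases j <;>
    simp [blk, Matrix.mul_apply, Fin.sum_univ_four, *]

theorem kg_inv {a R c F : ℝ} (hS : R ^ 2 + a ^ 2 * c ^ 2 ≠ 0) (hD : R ^ 2 + a ^ 2 - F ≠ 0)
    (hc : 1 - c ^ 2 ≠ 0) : (kg a R c F)⁻¹ = kgInv a R c F := by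
  have h1 : (-((R ^ 2 + a ^ 2 * c ^ 2) / (R ^ 2 + a ^ 2 - F)))⁻¹ =
      -((R ^ 2 + a ^ 2 - F) / (R ^ 2 + a ^ 2 * c ^ 2)) := by rw [inv_neg, inv_div]
  have h2 : (-(R ^ 2 + a ^ 2 * c ^ 2))⁻¹ = -(1 / (R ^ 2 + a ^ 2 * c ^ 2)) := by
    rw [inv_neg, one_div]
  rw [kg, kgInv, ← h1, ← h2]
  apply blk_inv (neg_ne_zero.2 (div_ne_zero hS hD)) (neg_ne_zero.2 hS) <;> field_simp <;> ring

/-- The radial derivative of `F / Σ`. -/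
def potR (a R c F F' : ℝ) : ℝ :=
  (F' * (R ^ 2 + a ^ 2 * c ^ 2) - 2 * R * F) / (R ^ 2 + a ^ 2 * c ^ 2) ^ 2

/-- The second radial derivative of `F / Σ`. -/
def potRR (a R c F F' F'' : ℝ) : ℝ :=
  (F'' * (R ^ 2 + a ^ 2 * c ^ 2) - 2 * F) / (R ^ 2 + a ^ 2 * c ^ 2) ^ 2 -
    4 * R * potR a R c F F' / (R ^ 2 + a ^ 2 * c ^ 2)

/-- The angular derivative of `F / Σ`, with `s = sin ϑ`. -/
def potθ (a R s c F : ℝ) : ℝ :=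
  2 * a ^ 2 * s * c * F / (R ^ 2 + a ^ 2 * c ^ 2) ^ 2

/-- The radial derivative of `kg`. -/
def kgR (a R c F F' : ℝ) : Matrix (Fin 4) (Fin 4) ℝ :=
  blk (-potR a R c F F')
    (a * (1 - c ^ 2) * potR a R c F F')
    (-((2 * R * (R ^ 2 + a ^ 2 - F) - (R ^ 2 + a ^ 2 * c ^ 2) * (2 * R - F')) /
      (R ^ 2 + a ^ 2 - F) ^ 2))
    0
    (-(2 * R))
    (-((1 - c ^ 2) * (2 * R)) - a ^ 2 * (1 - c ^ 2) ^ 2 * potR a R c F F')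

/-- The angular derivative of `kg`. -/
def kgθ (a R s c F : ℝ) : Matrix (Fin 4) (Fin 4) ℝ :=
  blk (-potθ a R s c F)
    (a * (2 * s * c) * (F / (R ^ 2 + a ^ 2 * c ^ 2)) + a * (1 - c ^ 2) * potθ a R s c F)
    (2 * a ^ 2 * s * c / (R ^ 2 + a ^ 2 - F))
    0
    (2 * a ^ 2 * s * c)
    (-(2 * s * c * (R ^ 2 + a ^ 2)) -
      (a ^ 2 * (4 * (1 - c ^ 2) * s * c) * (F / (R ^ 2 + a ^ 2 * c ^ 2)) +
        a ^ 2 * (1 - c ^ 2) ^ 2 * potθ a R s c F))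

theorem hasDerivAt_sig_R (a c R : ℝ) :
    HasDerivAt (fun r : ℝ => r ^ 2 + a ^ 2 * c ^ 2) (2 * R) R := by
  simpa using (hasDerivAt_pow 2 R).add_const (a ^ 2 * c ^ 2)

theorem hasDerivAt_sig_θ (a R θ : ℝ) :
    HasDerivAt (fun t : ℝ => R ^ 2 + a ^ 2 * cos t ^ 2) (-(2 * a ^ 2 * sin θ * cos θ)) θ := by
  refine ((((hasDerivAt_cos θ).pow 2).const_mul (a ^ 2)).const_add (R ^ 2)).congr_deriv ?_
  simp; ring

theorem hasDerivAt_one_sub_cos_sq (θ : ℝ) :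
    HasDerivAt (fun t : ℝ => 1 - cos t ^ 2) (2 * sin θ * cos θ) θ := by
  refine (((hasDerivAt_cos θ).pow 2).const_sub 1).congr_deriv ?_
  simp; ring

theorem hasDerivAt_del {a R : ℝ} {F : ℝ → ℝ} {F' : ℝ} (hF : HasDerivAt F F' R) :
    HasDerivAt (fun r : ℝ => r ^ 2 + a ^ 2 - F r) (2 * R - F') R := by
  exact (((hasDerivAt_pow 2 R).add_const (a ^ 2)).sub hF).congr_deriv (by simp)

theorem hasDerivAt_pot_R {a c R : ℝ} {F : ℝ → ℝ} {F' : ℝ} (hS : R ^ 2 + a ^ 2 * c ^ 2 ≠ 0)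
    (hF : HasDerivAt F F' R) :
    HasDerivAt (fun r => F r / (r ^ 2 + a ^ 2 * c ^ 2)) (potR a R c (F R) F') R := by
  refine (hF.div (hasDerivAt_sig_R a c R) hS).congr_deriv ?_
  rw [potR]; ring

theorem hasDerivAt_potR {a c R : ℝ} {F F' : ℝ → ℝ} {F'' : ℝ} (hS : R ^ 2 + a ^ 2 * c ^ 2 ≠ 0)
    (hF : HasDerivAt F (F' R) R) (hF' : HasDerivAt F' F'' R) :
    HasDerivAt (fun r => potR a r c (F r) (F' r)) (potRR a R c (F R) (F' R) F'') R := by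
  have h1 := hasDerivAt_sig_R a c R
  refine (((hF'.mul h1).sub (((hasDerivAt_id R).const_mul 2).mul hF)).div (h1.pow 2)
    (pow_ne_zero 2 hS)).congr_deriv ?_
  simp only [potRR, potR, id]
  simp
  field_simp
  ring

theorem hasDerivAt_pot_θ {a R F θ : ℝ} (hS : R ^ 2 + a ^ 2 * cos θ ^ 2 ≠ 0) :
    HasDerivAt (fun t => F / (R ^ 2 + a ^ 2 * cos t ^ 2)) (potθ a R (sin θ) (cos θ) F) θ := by
  refine ((hasDerivAt_const θ F).div (hasDerivAt_sig_θ a R θ) hS).congr_deriv ?_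
  rw [potθ]; ring

theorem hasDerivAt_kg_R {a c R : ℝ} {F : ℝ → ℝ} {F' : ℝ} (hS : R ^ 2 + a ^ 2 * c ^ 2 ≠ 0)
    (hD : R ^ 2 + a ^ 2 - F R ≠ 0) (hF : HasDerivAt F F' R) (i j : Fin 4) :
    HasDerivAt (fun r => kg a r c (F r) i j) (kgR a R c (F R) F' i j) R := by
  have hH := hasDerivAt_pot_R hS hF
  have h0 := hasDerivAt_const R (0 : ℝ)
  have h00 := hH.const_sub 1
  have h03 := hH.const_mul (a * (1 - c ^ 2))
  have h11 := ((hasDerivAt_sig_R a c R).div (hasDerivAt_del (a := a) hF) hD).neg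
  have h22 := (hasDerivAt_sig_R a c R).neg
  -- The stated derivative comes from `A² - a² sin²ϑ Δ = AΣ + a² sin²ϑ F`, which turns `g_φφ` into
  -- `-sin²ϑ A - a² sin⁴ϑ F/Σ`.
  have h33 : HasDerivAt (fun r => -((1 - c ^ 2) / (r ^ 2 + a ^ 2 * c ^ 2) *
      ((r ^ 2 + a ^ 2) ^ 2 - a ^ 2 * (1 - c ^ 2) * (r ^ 2 + a ^ 2 - F r))))
      (-((1 - c ^ 2) * (2 * R)) - a ^ 2 * (1 - c ^ 2) ^ 2 * potR a R c (F R) F') R := by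
    have hR := hasDerivAt_sig_R a 1 R
    simp only [one_pow, mul_one] at hR
    refine (((hasDerivAt_const R (1 - c ^ 2)).div (hasDerivAt_sig_R a c R) hS).mul
      ((hR.pow 2).sub ((hasDerivAt_del hF).const_mul (a ^ 2 * (1 - c ^ 2))))).neg.congr_deriv ?_
    simp only [Pi.sub_apply, Pi.pow_apply, Pi.div_apply, Nat.add_one_sub_one, pow_one,
      Nat.cast_ofNat, potR]
    field_simp
    ring
  fin_cases i <;> fin_cases j <;>
    first
    | exact h0 | exact h00 | exact h03 | exact h11 | exact h22 | exact h33

theorem hasDerivAt_kg_θ {a R F θ : ℝ} (hS : R ^ 2 + a ^ 2 * cos θ ^ 2 ≠ 0) (i j : Fin 4) :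
    HasDerivAt (fun t => kg a R (cos t) F i j) (kgθ a R (sin θ) (cos θ) F i j) θ := by
  have hH := hasDerivAt_pot_θ (F := F) hS
  have hw := hasDerivAt_one_sub_cos_sq θ
  have h0 := hasDerivAt_const θ (0 : ℝ)
  have h00 := hH.const_sub 1
  have h03 := (hw.const_mul a).mul hH
  have h11 := ((hasDerivAt_sig_θ a R θ).div_const (R ^ 2 + a ^ 2 - F)).neg
  have h22 := (hasDerivAt_sig_θ a R θ).neg
  have h33 : HasDerivAt (fun t => -((1 - cos t ^ 2) / (R ^ 2 + a ^ 2 * cos t ^ 2) *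
      ((R ^ 2 + a ^ 2) ^ 2 - a ^ 2 * (1 - cos t ^ 2) * (R ^ 2 + a ^ 2 - F))))
      (-(2 * sin θ * cos θ * (R ^ 2 + a ^ 2)) -
        (a ^ 2 * (4 * (1 - cos θ ^ 2) * sin θ * cos θ) * (F / (R ^ 2 + a ^ 2 * cos θ ^ 2)) +
          a ^ 2 * (1 - cos θ ^ 2) ^ 2 * potθ a R (sin θ) (cos θ) F)) θ := by
    refine ((hw.div (hasDerivAt_sig_θ a R θ) hS).mul (((hw.const_mul (a ^ 2)).mul_const
      (R ^ 2 + a ^ 2 - F)).const_sub ((R ^ 2 + a ^ 2) ^ 2))).neg.congr_deriv ?_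
    simp only [Pi.div_apply, potθ]
    generalize sin θ = s at *
    generalize cos θ = c at *
    obtain ⟨z, hz⟩ : ∃ z, R ^ 2 + a ^ 2 * c ^ 2 = z := ⟨_, rfl⟩
    simp only [hz] at hS ⊢
    field_simp
    subst hz
    ring
  fin_cases i <;> fin_cases j <;>
    first
    | exact h0 | exact h00 | exact h03
    | exact h11.congr_deriv (by
        change _ = 2 * a ^ 2 * sin θ * cos θ / (R ^ 2 + a ^ 2 - F)
        ring)
    | exact h22.congr_deriv (neg_neg _)
    | exact h33

/-! ### Christoffel symbols in closed form -/

/-- The Christoffel symbols of a block metric depending on `R` and `ϑ` only. -/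
theorem christoffel_sum_blk {A B g h C a0 a3 a1 a2 a33 b0 b3 b1 b2 b33 : ℝ} (l m n : Fin 4) :
    (1 / 2) * ∑ k, blk A B g 0 h C l k *
      ((![0, blk a0 a3 a1 0 a2 a33, blk b0 b3 b1 0 b2 b33, 0] :
          Fin 4 → Matrix (Fin 4) (Fin 4) ℝ) n k m +
        (![0, blk a0 a3 a1 0 a2 a33, blk b0 b3 b1 0 b2 b33, 0] :
          Fin 4 → Matrix (Fin 4) (Fin 4) ℝ) m k n -
        (![0, blk a0 a3 a1 0 a2 a33, blk b0 b3 b1 0 b2 b33, 0] :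
          Fin 4 → Matrix (Fin 4) (Fin 4) ℝ) k m n) =
      (![off ((A * a0 + B * a3) / 2) ((A * b0 + B * b3) / 2)
          ((A * a3 + B * a33) / 2) ((A * b3 + B * b33) / 2),
        blk (-(g * a0 / 2)) (-(g * a3 / 2)) (g * a1 / 2) (g * b1 / 2) (-(g * a2 / 2))
          (-(g * a33 / 2)),
        blk (-(h * b0 / 2)) (-(h * b3 / 2)) (-(h * b1 / 2)) (h * a2 / 2) (h * b2 / 2)
          (-(h * b33 / 2)),
        off ((B * a0 + C * a3) / 2) ((B * b0 + C * b3) / 2)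
          ((B * a3 + C * a33) / 2) ((B * b3 + C * b33) / 2)] :
        Fin 4 → Matrix (Fin 4) (Fin 4) ℝ) l m n := by
  rw [Fin.sum_univ_four]
  fin_cases l <;> fin_cases m <;> fin_cases n <;>
    dsimp only [Fin.zero_eta, Fin.mk_one, Fin.reduceFinMk] <;>
    simp only [vec4_apply, blk_apply, off_apply, Matrix.zero_apply] <;> ring

/-- The Christoffel symbols of `kg`, with `s = sin ϑ` and `F' = ∂_R F`. -/
def kGam (a R s c F F' : ℝ) : Fin 4 → Matrix (Fin 4) (Fin 4) ℝ :=
  let S := R ^ 2 + a ^ 2 * c ^ 2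
  let D := R ^ 2 + a ^ 2 - F
  let w := 1 - c ^ 2
  let H := potR a R c F F'
  ![off (-((R ^ 2 + a ^ 2) * (H / (2 * D))))
      (-(a ^ 2 * F * (s * c / S ^ 2)))
      (a * w * (R ^ 2 + a ^ 2) * (H / (2 * D)) - a * w * F * (R / (S * D)))
      (a ^ 3 * F * w * (s * c / S ^ 2)),
    blk (-(D * H / (2 * S)))
      (a * w * (D * H / (2 * S)))
      (R / S - (2 * R - F') / (2 * D))
      (-(a ^ 2 * (s * c / S)))
      (-(D * R / S))
      (-(w * (D * R / S) + a ^ 2 * w ^ 2 * (D * H / (2 * S)))),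
    blk (-(a ^ 2 * F * (s * c / S ^ 3)))
      (a * F * (R ^ 2 + a ^ 2) * (s * c / S ^ 3))
      (a ^ 2 / D * (s * c / S))
      (R / S)
      (-(a ^ 2 * (s * c / S)))
      (-((R ^ 2 + a ^ 2) * (s * c / S) + 2 * a ^ 2 * F * (w * (s * c / S ^ 2)) +
        a ^ 4 * F * (w ^ 2 * (s * c / S ^ 3)))),
    off (-(a * (H / (2 * D))))
      (-(a * F * (s * c / (w * S ^ 2))))
      (a ^ 2 * w * (H / (2 * D)) + R / S - a ^ 2 * w * (R / (S * D)))
      (s * c / w + a ^ 2 * F * (s * c / S ^ 2))]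

theorem off_congr {x y z w x' y' z' w' : ℝ} (h1 : x = x') (h2 : y = y') (h3 : z = z')
    (h4 : w = w') : off x y z w = off x' y' z' w' := by
  rw [h1, h2, h3, h4]

theorem blk_congr {p q u d v w p' q' u' d' v' w' : ℝ} (h1 : p = p') (h2 : q = q') (h3 : u = u')
    (h4 : d = d') (h5 : v = v') (h6 : w = w') : blk p q u d v w = blk p' q' u' d' v' w' := by
  rw [h1, h2, h3, h4, h5, h6]

theorem vec4_congr {α : Type*} {X Y Z W X' Y' Z' W' : α} (h1 : X = X') (h2 : Y = Y')
    (h3 : Z = Z') (h4 : W = W') : ![X, Y, Z, W] = ![X', Y', Z', W'] := by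
  rw [h1, h2, h3, h4]

theorem christoffel_sum_kg {a R s c F F' : ℝ} (hS : R ^ 2 + a ^ 2 * c ^ 2 ≠ 0)
    (hD : R ^ 2 + a ^ 2 - F ≠ 0) (hc : 1 - c ^ 2 ≠ 0) (l m n : Fin 4) :
    (1 / 2) * ∑ k, kgInv a R c F l k *
      ((![0, kgR a R c F F', kgθ a R s c F, 0] : Fin 4 → Matrix (Fin 4) (Fin 4) ℝ) n k m +
        (![0, kgR a R c F F', kgθ a R s c F, 0] : Fin 4 → Matrix (Fin 4) (Fin 4) ℝ) m k n -
        (![0, kgR a R c F F', kgθ a R s c F, 0] : Fin 4 → Matrix (Fin 4) (Fin 4) ℝ) k m n) =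
      kGam a R s c F F' l m n := by
  rw [kgInv, kgR, kgθ, christoffel_sum_blk]
  refine congrFun (congrFun (congrFun ?_ l) m) n
  rw [kGam]
  refine vec4_congr (off_congr ?_ ?_ ?_ ?_) (blk_congr ?_ ?_ ?_ ?_ ?_ ?_)
    (blk_congr ?_ ?_ ?_ ?_ ?_ ?_) (off_congr ?_ ?_ ?_ ?_) <;>
    (try simp only [potR, potθ]) <;> field_simp <;> ring

/-! ### Partial derivatives of functions of `R` and `ϑ` -/

theorem pd_congr {i : Fin 4} {f g : Coords → ℝ} {x : Coords}
    (h : ∀ᶠ s in nhds (x i), f (Function.update x i s) = g (Function.update x i s)) :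
    pd i f x = pd i g x :=
  Filter.EventuallyEq.deriv_eq h

theorem pd_comp (i : Fin 4) (f : ℝ → ℝ → ℝ) (x : Coords) :
    pd i (fun y => f (y 1) (y 2)) x =
      (![0, deriv (fun r => f r (x 2)) (x 1), deriv (fun t => f (x 1) t) (x 2), 0] :
        Fin 4 → ℝ) i := by
  fin_cases i <;> simp [pd]

/-- The part of the coordinate chart on which the metric is regular. -/
def chart (I : Set ℝ) : Set Coords := {x | x 1 ∈ I ∧ sin (x 2) ≠ 0}

theorem eventually_update_mem_chart {I : Set ℝ} (hI : IsOpen I) {x : Coords} (hx : x ∈ chart I)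
    (i : Fin 4) : ∀ᶠ s in nhds (x i), Function.update x i s ∈ chart I := by
  have hc : IsOpen (chart I) := by
    refine (hI.preimage (continuous_apply 1)).inter ?_
    exact isOpen_ne_fun (continuous_sin.comp (continuous_apply 2)) continuous_const
  have h : Filter.Tendsto (fun s => Function.update x i s) (nhds (x i)) (nhds x) := by
    have := ((continuous_const (y := x)).update i continuous_id).tendsto (x i)
    simpa using this
  exact h.eventually (hc.mem_nhds hx)

/-- The closed form of the Christoffel symbols is known only on `chart I`. This set is open, so a
partial derivative at one of its points sees only values given by the closed form. -/
theorem pd_eq_of_eqOn {I : Set ℝ} (hI : IsOpen I) {i : Fin 4} {f : Coords → ℝ} {h : ℝ → ℝ → ℝ}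
    (hf : ∀ y ∈ chart I, f y = h (y 1) (y 2)) {x : Coords} (hx : x ∈ chart I) :
    pd i f x = (![0, deriv (fun r => h r (x 2)) (x 1), deriv (fun t => h (x 1) t) (x 2), 0] :
        Fin 4 → ℝ) i := by
  rw [← pd_comp]
  exact pd_congr ((eventually_update_mem_chart hI hx i).mono fun s hs => hf _ hs)

/-! ### Christoffel symbols -/

/-- The Kerrr metric in terms of `F(R) = 2 R M(R)`. -/
def kerr (a : ℝ) (F : ℝ → ℝ) (x : Coords) : Matrix (Fin 4) (Fin 4) ℝ :=
  kg a (x 1) (cos (x 2)) (F (x 1))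

/-- The standing regularity hypotheses on `F = 2RM` and `I`. -/
structure Regular (a : ℝ) (F F' F'' : ℝ → ℝ) (I : Set ℝ) : Prop where
  isOpen : IsOpen I
  pos : ∀ R ∈ I, 0 < R
  del_pos : ∀ R ∈ I, 0 < R ^ 2 + a ^ 2 - F R
  hasDerivAt : ∀ R ∈ I, HasDerivAt F (F' R) R
  hasDerivAt' : ∀ R ∈ I, HasDerivAt F' (F'' R) R

variable {a : ℝ} {F F' F'' : ℝ → ℝ} {I : Set ℝ}

theorem Regular.sig_pos (h : Regular a F F' F'' I) {R : ℝ} (hR : R ∈ I) (c : ℝ) :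
    0 < R ^ 2 + a ^ 2 * c ^ 2 := by
  have := h.pos R hR
  positivity

theorem one_sub_cos_sq_ne {θ : ℝ} (h : sin θ ≠ 0) : 1 - cos θ ^ 2 ≠ 0 := by
  rw [← sin_sq]
  exact pow_ne_zero 2 h

theorem pd_kerr (h : Regular a F F' F'' I) {x : Coords} (hx : x ∈ chart I) (k i j : Fin 4) :
    pd k (fun y => kerr a F y i j) x =
      (![0, kgR a (x 1) (cos (x 2)) (F (x 1)) (F' (x 1)),
        kgθ a (x 1) (sin (x 2)) (cos (x 2)) (F (x 1)), 0] :
          Fin 4 → Matrix (Fin 4) (Fin 4) ℝ) k i j := by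
  have hS := (h.sig_pos hx.1 (cos (x 2))).ne'
  have e := pd_comp k (fun r t => kg a r (cos t) (F r) i j) x
  rw [(hasDerivAt_kg_R hS (h.del_pos _ hx.1).ne' (h.hasDerivAt _ hx.1) i j).deriv,
    (hasDerivAt_kg_θ hS i j).deriv] at e
  refine e.trans ?_
  fin_cases k <;> rfl

theorem christoffel_kerr (h : Regular a F F' F'' I) {x : Coords} (hx : x ∈ chart I)
    (l m n : Fin 4) :
    christoffel (kerr a F) l m n x =
      kGam a (x 1) (sin (x 2)) (cos (x 2)) (F (x 1)) (F' (x 1)) l m n := by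
  have hS := (h.sig_pos hx.1 (cos (x 2))).ne'
  have hD := (h.del_pos _ hx.1).ne'
  have hc := one_sub_cos_sq_ne hx.2
  rw [← christoffel_sum_kg hS hD hc l m n]
  simp only [christoffel, pd_kerr h hx]
  rw [kerr, kg_inv hS hD hc]

theorem pd_christoffel_kerr (h : Regular a F F' F'' I) {x : Coords} (hx : x ∈ chart I)
    (k l m n : Fin 4) :
    pd k (christoffel (kerr a F) l m n) x =
      (![0, deriv (fun r => kGam a r (sin (x 2)) (cos (x 2)) (F r) (F' r) l m n) (x 1),
        deriv (fun t => kGam a (x 1) (sin t) (cos t) (F (x 1)) (F' (x 1)) l m n) (x 2), 0] :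
          Fin 4 → ℝ) k :=
  pd_eq_of_eqOn h.isOpen
    (h := fun r t => kGam a r (sin t) (cos t) (F r) (F' r) l m n)
    (fun _ hy => christoffel_kerr h hy l m n) hx

/-! ### Derivatives of the Christoffel symbols -/

/-- The radial derivative of `Δ ∂_R(F/Σ) / (2Σ)`. -/
def dB (a R c F F₁ F₂ : ℝ) : ℝ :=
  ((2 * R - F₁) * potR a R c F F₁ + (R ^ 2 + a ^ 2 - F) * potRR a R c F F₁ F₂) /
      (2 * (R ^ 2 + a ^ 2 * c ^ 2)) -
    (R ^ 2 + a ^ 2 - F) * potR a R c F F₁ * R / (R ^ 2 + a ^ 2 * c ^ 2) ^ 2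

/-- The radial derivative of `ΔR/Σ`. -/
def dA (a R c F F₁ : ℝ) : ℝ :=
  ((2 * R - F₁) * R + (R ^ 2 + a ^ 2 - F)) / (R ^ 2 + a ^ 2 * c ^ 2) -
    2 * R ^ 2 * (R ^ 2 + a ^ 2 - F) / (R ^ 2 + a ^ 2 * c ^ 2) ^ 2

/-- The radial derivative of `∂_R(F/Σ) / (2Δ)`. -/
def dE (a R c F F₁ F₂ : ℝ) : ℝ :=
  potRR a R c F F₁ F₂ / (2 * (R ^ 2 + a ^ 2 - F)) -
    potR a R c F F₁ * (2 * R - F₁) / (2 * (R ^ 2 + a ^ 2 - F) ^ 2)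

/-- The radial derivative of `R/Σ`. -/
def dQ (a R c : ℝ) : ℝ :=
  1 / (R ^ 2 + a ^ 2 * c ^ 2) - 2 * R ^ 2 / (R ^ 2 + a ^ 2 * c ^ 2) ^ 2

/-- The radial derivative of `R / (ΣΔ)`. -/
def dU (a R c F F₁ : ℝ) : ℝ :=
  1 / ((R ^ 2 + a ^ 2 * c ^ 2) * (R ^ 2 + a ^ 2 - F)) -
    2 * R ^ 2 / ((R ^ 2 + a ^ 2 * c ^ 2) ^ 2 * (R ^ 2 + a ^ 2 - F)) -
    R * (2 * R - F₁) / ((R ^ 2 + a ^ 2 * c ^ 2) * (R ^ 2 + a ^ 2 - F) ^ 2)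

/-- The angular derivative of `sin ϑ cos ϑ / Σ ^ n`. -/
def dK (n : ℕ) (a R c : ℝ) : ℝ :=
  (2 * c ^ 2 - 1) / (R ^ 2 + a ^ 2 * c ^ 2) ^ n +
    2 * n * a ^ 2 * (1 - c ^ 2) * c ^ 2 / (R ^ 2 + a ^ 2 * c ^ 2) ^ (n + 1)

section Radial

variable {R c F₁ F₂ : ℝ}

theorem hasDerivAt_B (hS : R ^ 2 + a ^ 2 * c ^ 2 ≠ 0) (hF : HasDerivAt F (F' R) R)
    (hF' : HasDerivAt F' F₂ R) :
    HasDerivAt (fun r => (r ^ 2 + a ^ 2 - F r) * potR a r c (F r) (F' r) /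
        (2 * (r ^ 2 + a ^ 2 * c ^ 2))) (dB a R c (F R) (F' R) F₂) R := by
  refine (((hasDerivAt_del hF).mul (hasDerivAt_potR hS hF hF')).div
    ((hasDerivAt_sig_R a c R).const_mul 2) (mul_ne_zero two_ne_zero hS)).congr_deriv ?_
  simp only [Pi.mul_apply, dB]
  field_simp

theorem hasDerivAt_A (hS : R ^ 2 + a ^ 2 * c ^ 2 ≠ 0) (hF : HasDerivAt F F₁ R) :
    HasDerivAt (fun r => (r ^ 2 + a ^ 2 - F r) * r / (r ^ 2 + a ^ 2 * c ^ 2))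
      (dA a R c (F R) F₁) R := by
  refine (((hasDerivAt_del hF).mul (hasDerivAt_id R)).div (hasDerivAt_sig_R a c R)
    hS).congr_deriv ?_
  simp only [Pi.mul_apply, id, dA]
  field_simp

theorem hasDerivAt_E (hS : R ^ 2 + a ^ 2 * c ^ 2 ≠ 0) (hD : R ^ 2 + a ^ 2 - F R ≠ 0)
    (hF : HasDerivAt F (F' R) R) (hF' : HasDerivAt F' F₂ R) :
    HasDerivAt (fun r => potR a r c (F r) (F' r) / (2 * (r ^ 2 + a ^ 2 - F r)))
      (dE a R c (F R) (F' R) F₂) R := by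
  refine ((hasDerivAt_potR hS hF hF').div ((hasDerivAt_del hF).const_mul 2)
    (mul_ne_zero two_ne_zero hD)).congr_deriv ?_
  simp only [dE]
  field_simp

theorem hasDerivAt_Q (hS : R ^ 2 + a ^ 2 * c ^ 2 ≠ 0) :
    HasDerivAt (fun r => r / (r ^ 2 + a ^ 2 * c ^ 2)) (dQ a R c) R := by
  refine ((hasDerivAt_id R).div (hasDerivAt_sig_R a c R) hS).congr_deriv ?_
  simp only [id, dQ]
  field_simp

theorem hasDerivAt_U (hS : R ^ 2 + a ^ 2 * c ^ 2 ≠ 0)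
    (hD : R ^ 2 + a ^ 2 - F R ≠ 0) (hF : HasDerivAt F F₁ R) :
    HasDerivAt (fun r => r / ((r ^ 2 + a ^ 2 * c ^ 2) * (r ^ 2 + a ^ 2 - F r)))
      (dU a R c (F R) F₁) R := by
  refine ((hasDerivAt_id R).div ((hasDerivAt_sig_R a c R).mul (hasDerivAt_del hF))
    (mul_ne_zero hS hD)).congr_deriv ?_
  simp only [Pi.mul_apply, id, dU]
  field_simp
  ring

end Radial

section Angular

variable {R θ : ℝ}

theorem hasDerivAt_K (hS : R ^ 2 + a ^ 2 * cos θ ^ 2 ≠ 0) (n : ℕ) :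
    HasDerivAt (fun t => sin t * cos t / (R ^ 2 + a ^ 2 * cos t ^ 2) ^ n) (dK n a R (cos θ)) θ := by
  refine (((hasDerivAt_sin θ).mul (hasDerivAt_cos θ)).div ((hasDerivAt_sig_θ a R θ).pow n)
    (pow_ne_zero n hS)).congr_deriv ?_
  have hs := sin_sq θ
  -- The power rule produces the exponent `n - 1`, which truncates at `n = 0`.
  rcases n with _ | n
  · simp [dK]
    linear_combination -hs
  · simp only [Pi.mul_apply, Pi.pow_apply, Nat.add_sub_cancel, Nat.cast_add, Nat.cast_one,
      pow_succ _ n, pow_succ _ (n + 1), dK]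
    generalize R ^ 2 + a ^ 2 * cos θ ^ 2 = z at hS
    have hP : z ^ n ≠ 0 := pow_ne_zero n hS
    generalize z ^ n = P at hP
    linear_combination (norm := (field_simp; ring))
      (-(1 / (P * z)) + 2 * (n + 1) * a ^ 2 * cos θ ^ 2 / (P * z * z)) * hs

theorem hasDerivAt_K_one (hS : R ^ 2 + a ^ 2 * cos θ ^ 2 ≠ 0) :
    HasDerivAt (fun t => sin t * cos t / (R ^ 2 + a ^ 2 * cos t ^ 2)) (dK 1 a R (cos θ)) θ := by
  simpa using hasDerivAt_K hS 1

theorem hasDerivAt_mul_K (hS : R ^ 2 + a ^ 2 * cos θ ^ 2 ≠ 0) (n : ℕ) :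
    HasDerivAt (fun t => (1 - cos t ^ 2) * (sin t * cos t / (R ^ 2 + a ^ 2 * cos t ^ 2) ^ n))
      (2 * (1 - cos θ ^ 2) * cos θ ^ 2 / (R ^ 2 + a ^ 2 * cos θ ^ 2) ^ n +
        (1 - cos θ ^ 2) * dK n a R (cos θ)) θ := by
  refine ((hasDerivAt_one_sub_cos_sq θ).mul (hasDerivAt_K hS n)).congr_deriv ?_
  linear_combination 2 * cos θ ^ 2 / (R ^ 2 + a ^ 2 * cos θ ^ 2) ^ n * sin_sq θ

theorem hasDerivAt_sq_mul_K (hS : R ^ 2 + a ^ 2 * cos θ ^ 2 ≠ 0) (n : ℕ) :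
    HasDerivAt (fun t => (1 - cos t ^ 2) ^ 2 * (sin t * cos t / (R ^ 2 + a ^ 2 * cos t ^ 2) ^ n))
      (4 * (1 - cos θ ^ 2) ^ 2 * cos θ ^ 2 / (R ^ 2 + a ^ 2 * cos θ ^ 2) ^ n +
        (1 - cos θ ^ 2) ^ 2 * dK n a R (cos θ)) θ := by
  refine (((hasDerivAt_one_sub_cos_sq θ).pow 2).mul (hasDerivAt_K hS n)).congr_deriv ?_
  simp only [Pi.pow_apply, Nat.add_one_sub_one, pow_one, Nat.cast_ofNat]
  linear_combination
    4 * (1 - cos θ ^ 2) * cos θ ^ 2 / (R ^ 2 + a ^ 2 * cos θ ^ 2) ^ n * sin_sq θ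

theorem hasDerivAt_cot (hθ : sin θ ≠ 0) :
    HasDerivAt (fun t => sin t * cos t / (1 - cos t ^ 2)) (-(1 / (1 - cos θ ^ 2))) θ := by
  have hw := one_sub_cos_sq_ne hθ
  refine (((hasDerivAt_sin θ).mul (hasDerivAt_cos θ)).div (hasDerivAt_one_sub_cos_sq θ)
    hw).congr_deriv ?_
  have hs := sin_sq θ
  simp only [Pi.mul_apply]
  generalize sin θ = s at *
  generalize cos θ = c at *
  linear_combination (norm := (field_simp; ring))
    (-(1 / (1 - c ^ 2)) - 2 * c ^ 2 / (1 - c ^ 2) ^ 2) * hs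

end Angular

/-! ### The Ricci tensor -/

/-- The part of the Ricci tensor that is quadratic in the Christoffel symbols. -/
def quad (G : Fin 4 → Matrix (Fin 4) (Fin 4) ℝ) (m n : Fin 4) : ℝ :=
  ∑ l, ∑ s, (G s m l * G l n s - G s m n * G l l s)

section Quad

variable (t₁ t₂ t₃ t₄ p₁ p₂ p₃ p₄ r₀ r₃ r₁ d₁ r₂ r₄ q₀ q₃ q₁ d₂ q₂ q₄ : ℝ)

/-- In this formula and its companions the two four-term brackets are the traces `Γ^l_{lR}` and
`Γ^l_{lϑ}`; the traces in `t` and `φ` vanish. -/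
theorem quad_tt :
    quad ![off t₁ t₂ t₃ t₄, blk r₀ r₃ r₁ d₁ r₂ r₄, blk q₀ q₃ q₁ d₂ q₂ q₄, off p₁ p₂ p₃ p₄] 0 0 =
      2 * (r₀ * t₁ + r₃ * p₁ + q₀ * t₂ + q₃ * p₂) -
        (r₀ * (t₁ + r₁ + d₂ + p₃) + q₀ * (t₂ + d₁ + q₂ + p₄)) := by
  simp only [quad, Fin.sum_univ_four, vec4_apply, off_apply, blk_apply]
  ring

theorem quad_tφ :
    quad ![off t₁ t₂ t₃ t₄, blk r₀ r₃ r₁ d₁ r₂ r₄, blk q₀ q₃ q₁ d₂ q₂ q₄, off p₁ p₂ p₃ p₄] 0 3 =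
      r₀ * t₃ + r₃ * p₃ + q₀ * t₄ + q₃ * p₄ + t₁ * r₃ + t₂ * q₃ + p₁ * r₄ + p₂ * q₄ -
        (r₃ * (t₁ + r₁ + d₂ + p₃) + q₃ * (t₂ + d₁ + q₂ + p₄)) := by
  simp only [quad, Fin.sum_univ_four, vec4_apply, off_apply, blk_apply]
  ring

theorem quad_φt :
    quad ![off t₁ t₂ t₃ t₄, blk r₀ r₃ r₁ d₁ r₂ r₄, blk q₀ q₃ q₁ d₂ q₂ q₄, off p₁ p₂ p₃ p₄] 3 0 =
      quad ![off t₁ t₂ t₃ t₄, blk r₀ r₃ r₁ d₁ r₂ r₄, blk q₀ q₃ q₁ d₂ q₂ q₄, off p₁ p₂ p₃ p₄]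
        0 3 := by
  simp only [quad, Fin.sum_univ_four, vec4_apply, off_apply, blk_apply]
  ring

theorem quad_φφ :
    quad ![off t₁ t₂ t₃ t₄, blk r₀ r₃ r₁ d₁ r₂ r₄, blk q₀ q₃ q₁ d₂ q₂ q₄, off p₁ p₂ p₃ p₄] 3 3 =
      2 * (r₃ * t₃ + r₄ * p₃ + q₃ * t₄ + q₄ * p₄) -
        (r₄ * (t₁ + r₁ + d₂ + p₃) + q₄ * (t₂ + d₁ + q₂ + p₄)) := by
  simp only [quad, Fin.sum_univ_four, vec4_apply, off_apply, blk_apply]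
  ring

theorem quad_RR :
    quad ![off t₁ t₂ t₃ t₄, blk r₀ r₃ r₁ d₁ r₂ r₄, blk q₀ q₃ q₁ d₂ q₂ q₄, off p₁ p₂ p₃ p₄] 1 1 =
      t₁ ^ 2 + 2 * p₁ * t₃ + p₃ ^ 2 + r₁ ^ 2 + 2 * d₁ * q₁ + d₂ ^ 2 -
        (r₁ * (t₁ + r₁ + d₂ + p₃) + q₁ * (t₂ + d₁ + q₂ + p₄)) := by
  simp only [quad, Fin.sum_univ_four, vec4_apply, off_apply, blk_apply]
  ring

theorem quad_θθ :
    quad ![off t₁ t₂ t₃ t₄, blk r₀ r₃ r₁ d₁ r₂ r₄, blk q₀ q₃ q₁ d₂ q₂ q₄, off p₁ p₂ p₃ p₄] 2 2 =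
      t₂ ^ 2 + 2 * p₂ * t₄ + p₄ ^ 2 + d₁ ^ 2 + 2 * r₂ * d₂ + q₂ ^ 2 -
        (r₂ * (t₁ + r₁ + d₂ + p₃) + q₂ * (t₂ + d₁ + q₂ + p₄)) := by
  simp only [quad, Fin.sum_univ_four, vec4_apply, off_apply, blk_apply]
  ring

end Quad

/-- `8π` times the energy density that the Einstein tensor of the Kerrr metric defines. -/
def enr (a R c F F₁ : ℝ) : ℝ := (R * F₁ - F) / (R ^ 2 + a ^ 2 * c ^ 2) ^ 2

/-- `8π` times the tangential pressure that the Einstein tensor of the Kerrr metric defines. -/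
def prs (a R c F F₁ F₂ : ℝ) : ℝ := enr a R c F F₁ - F₂ / (2 * (R ^ 2 + a ^ 2 * c ^ 2))

section Algebra

variable {a R s c F F₁ F₂ : ℝ}

/-- In `kGam` the sine enters only through the product `s * c`. After this product is replaced by
`σ`, the claim is a rational identity modulo `σ² = (1 - c²)c²`, and the multiplier of `hσ` is the
coefficient of `σ²` in the quadratic part. The other components work in the same way. -/
theorem ricci_alg_tt (hS : R ^ 2 + a ^ 2 * c ^ 2 ≠ 0) (hD : R ^ 2 + a ^ 2 - F ≠ 0)
    (hw : 1 - c ^ 2 ≠ 0) (hs : s ^ 2 = 1 - c ^ 2) :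
    dB a R c F F₁ F₂ + a ^ 2 * F * dK 3 a R c + quad (kGam a R s c F F₁) 0 0 =
      -(prs a R c F F₁ F₂ * (R ^ 2 + a ^ 2 - F) / (R ^ 2 + a ^ 2 * c ^ 2)) -
        enr a R c F F₁ * a ^ 2 * (1 - c ^ 2) / (R ^ 2 + a ^ 2 * c ^ 2) := by
  have hσ : (s * c) ^ 2 = (1 - c ^ 2) * c ^ 2 := by rw [mul_pow, hs]
  simp only [kGam, quad_tt, dB, dK, prs, enr, potR, potRR]
  generalize s * c = σ at hσ
  push_cast
  linear_combination (norm := (field_simp; ring))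
    (2 * ((-(a ^ 2 * F / (R ^ 2 + a ^ 2 * c ^ 2) ^ 3)) * (-(a ^ 2 * F / (R ^ 2 +
      a ^ 2 * c ^ 2) ^ 2)) +
      (a * F * (R ^ 2 + a ^ 2) / (R ^ 2 + a ^ 2 * c ^ 2) ^ 3) * (-(a * F / ((1 - c ^ 2) * (R ^ 2 +
        a ^ 2 * c ^ 2) ^ 2)))) -
      (-(a ^ 2 * F / (R ^ 2 + a ^ 2 * c ^ 2) ^ 3)) * (1 / (1 - c ^ 2) - 2 * a ^ 2 / (R ^ 2 +
        a ^ 2 * c ^ 2))) * hσ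

theorem ricci_alg_tφ (hS : R ^ 2 + a ^ 2 * c ^ 2 ≠ 0) (hD : R ^ 2 + a ^ 2 - F ≠ 0)
    (hw : 1 - c ^ 2 ≠ 0) (hs : s ^ 2 = 1 - c ^ 2) :
    -(a * (1 - c ^ 2) * dB a R c F F₁ F₂) - a * F * (R ^ 2 + a ^ 2) * dK 3 a R c +
      quad (kGam a R s c F F₁) 0 3 =
      prs a R c F F₁ F₂ * (R ^ 2 + a ^ 2 - F) * a * (1 - c ^ 2) / (R ^ 2 + a ^ 2 * c ^ 2) +
        enr a R c F F₁ * a * (1 - c ^ 2) * (R ^ 2 + a ^ 2) / (R ^ 2 + a ^ 2 * c ^ 2) := by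
  have hσ : (s * c) ^ 2 = (1 - c ^ 2) * c ^ 2 := by rw [mul_pow, hs]
  simp only [kGam, quad_tφ, dB, dK, prs, enr, potR, potRR]
  generalize s * c = σ at hσ
  push_cast
  linear_combination (norm := (field_simp; ring))
    ((-(a ^ 2 * F / (R ^ 2 + a ^ 2 * c ^ 2) ^ 3)) * (a ^ 3 * F * (1 - c ^ 2) / (R ^ 2 +
      a ^ 2 * c ^ 2) ^ 2) +
      (a * F * (R ^ 2 + a ^ 2) / (R ^ 2 + a ^ 2 * c ^ 2) ^ 3) * (1 / (1 - c ^ 2) +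
        a ^ 2 * F / (R ^ 2 + a ^ 2 * c ^ 2) ^ 2) +
      (-(a ^ 2 * F / (R ^ 2 + a ^ 2 * c ^ 2) ^ 2)) * (a * F * (R ^ 2 + a ^ 2) / (R ^ 2 +
        a ^ 2 * c ^ 2) ^ 3) +
      (-(a * F / ((1 - c ^ 2) * (R ^ 2 + a ^ 2 * c ^ 2) ^ 2))) * (-((R ^ 2 + a ^ 2) / (R ^ 2 +
        a ^ 2 * c ^ 2) + 2 * a ^ 2 * F * (1 - c ^ 2) / (R ^ 2 + a ^ 2 * c ^ 2) ^ 2 +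
        a ^ 4 * F * (1 - c ^ 2) ^ 2 / (R ^ 2 + a ^ 2 * c ^ 2) ^ 3)) -
      (a * F * (R ^ 2 + a ^ 2) / (R ^ 2 + a ^ 2 * c ^ 2) ^ 3) * (1 / (1 - c ^ 2) - 2 *
        a ^ 2 / (R ^ 2 + a ^ 2 * c ^ 2))) * hσ

set_option maxRecDepth 4000 in
theorem ricci_alg_φφ (hS : R ^ 2 + a ^ 2 * c ^ 2 ≠ 0) (hD : R ^ 2 + a ^ 2 - F ≠ 0)
    (hw : 1 - c ^ 2 ≠ 0) (hs : s ^ 2 = 1 - c ^ 2) :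
    ((1 - c ^ 2) * dA a R c F F₁ + a ^ 2 * (1 - c ^ 2) ^ 2 * dB a R c F F₁ F₂) +
      ((R ^ 2 + a ^ 2) * dK 1 a R c +
        2 * a ^ 2 * F * (2 * (1 - c ^ 2) * c ^ 2 / (R ^ 2 + a ^ 2 * c ^ 2) ^ 2 +
          (1 - c ^ 2) * dK 2 a R c) +
        a ^ 4 * F * (4 * (1 - c ^ 2) ^ 2 * c ^ 2 / (R ^ 2 + a ^ 2 * c ^ 2) ^ 3 +
          (1 - c ^ 2) ^ 2 * dK 3 a R c)) + quad (kGam a R s c F F₁) 3 3 =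
      -(prs a R c F F₁ F₂ * (R ^ 2 + a ^ 2 - F) * a ^ 2 * (1 - c ^ 2) ^ 2 / (R ^ 2 +
        a ^ 2 * c ^ 2)) -
        enr a R c F F₁ * (1 - c ^ 2) * (R ^ 2 + a ^ 2) ^ 2 / (R ^ 2 + a ^ 2 * c ^ 2) := by
  have hσ : (s * c) ^ 2 = (1 - c ^ 2) * c ^ 2 := by rw [mul_pow, hs]
  simp only [kGam, quad_φφ, dA, dB, dK, prs, enr, potR, potRR]
  generalize s * c = σ at hσ
  push_cast
  -- `Σ`, `Δ` and `sin²ϑ` stay atoms while denominators are cleared; their definitions are needed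
  -- only in the final polynomial identity.
  obtain ⟨z, hz⟩ : ∃ z, R ^ 2 + a ^ 2 * c ^ 2 = z := ⟨_, rfl⟩
  obtain ⟨d, hd⟩ : ∃ d, R ^ 2 + a ^ 2 - F = d := ⟨_, rfl⟩
  obtain ⟨w, hw'⟩ : ∃ w, 1 - c ^ 2 = w := ⟨_, rfl⟩
  simp only [hz, hd, hw'] at hS hD hw hσ ⊢
  linear_combination (norm := (field_simp; subst hz hd hw'; ring))
    (2 * ((a * F * (R ^ 2 + a ^ 2) / z ^ 3) * (a ^ 3 * F * w / z ^ 2) +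
      (-((R ^ 2 + a ^ 2) / z + 2 * a ^ 2 * F * w / z ^ 2 +
        a ^ 4 * F * w ^ 2 / z ^ 3)) * (1 / w + a ^ 2 * F / z ^ 2)) -
      (-((R ^ 2 + a ^ 2) / z + 2 * a ^ 2 * F * w / z ^ 2 +
        a ^ 4 * F * w ^ 2 / z ^ 3)) * (1 / w - 2 * a ^ 2 / z)) * hσ

theorem ricci_alg_RR (hS : R ^ 2 + a ^ 2 * c ^ 2 ≠ 0) (hD : R ^ 2 + a ^ 2 - F ≠ 0)
    (hw : 1 - c ^ 2 ≠ 0) (hs : s ^ 2 = 1 - c ^ 2) :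
    -(2 * R * (potR a R c F F₁ / (2 * (R ^ 2 + a ^ 2 - F))) + (R ^ 2 +
      a ^ 2) * dE a R c F F₁ F₂) + dQ a R c +
      (a ^ 2 * (1 - c ^ 2) * dE a R c F F₁ F₂ + dQ a R c - a ^ 2 * (1 - c ^ 2) * dU a R c F F₁) -
      a ^ 2 / (R ^ 2 + a ^ 2 - F) * dK 1 a R c + quad (kGam a R s c F F₁) 1 1 =
      prs a R c F F₁ F₂ * (R ^ 2 + a ^ 2 * c ^ 2) / (R ^ 2 + a ^ 2 - F) := by
  have hσ : (s * c) ^ 2 = (1 - c ^ 2) * c ^ 2 := by rw [mul_pow, hs]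
  simp only [kGam, quad_RR, dE, dQ, dU, dK, prs, enr, potR, potRR]
  generalize s * c = σ at hσ
  push_cast
  linear_combination (norm := (field_simp; ring))
    (2 * (-(a ^ 2 / (R ^ 2 + a ^ 2 * c ^ 2))) * (a ^ 2 / ((R ^ 2 + a ^ 2 - F) * (R ^ 2 +
      a ^ 2 * c ^ 2))) -
      (a ^ 2 / ((R ^ 2 + a ^ 2 - F) * (R ^ 2 + a ^ 2 * c ^ 2))) * (1 / (1 - c ^ 2) - 2 *
        a ^ 2 / (R ^ 2 + a ^ 2 * c ^ 2))) * hσ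

theorem ricci_alg_θθ (hS : R ^ 2 + a ^ 2 * c ^ 2 ≠ 0) (hD : R ^ 2 + a ^ 2 - F ≠ 0)
    (hw : 1 - c ^ 2 ≠ 0) (hs : s ^ 2 = 1 - c ^ 2) :
    -(a ^ 2 * F * dK 2 a R c) - a ^ 2 * dK 1 a R c +
      (-(1 / (1 - c ^ 2)) + a ^ 2 * F * dK 2 a R c) + dA a R c F F₁ + quad (kGam a R s c F F₁) 2 2 =
      -(enr a R c F F₁ * (R ^ 2 + a ^ 2 * c ^ 2)) := by
  have hσ : (s * c) ^ 2 = (1 - c ^ 2) * c ^ 2 := by rw [mul_pow, hs]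
  simp only [kGam, quad_θθ, dA, dK, enr, potR]
  generalize s * c = σ at hσ
  push_cast
  linear_combination (norm := (field_simp; ring))
    ((-(a ^ 2 * F / (R ^ 2 + a ^ 2 * c ^ 2) ^ 2)) ^ 2 + 2 * (-(a * F / ((1 - c ^ 2) * (R ^ 2 +
      a ^ 2 * c ^ 2) ^ 2))) * (a ^ 3 * F * (1 - c ^ 2) / (R ^ 2 + a ^ 2 * c ^ 2) ^ 2) +
      (1 / (1 - c ^ 2) + a ^ 2 * F / (R ^ 2 + a ^ 2 * c ^ 2) ^ 2) ^ 2 + 2 * (-(a ^ 2 / (R ^ 2 +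
        a ^ 2 * c ^ 2))) ^ 2 -
      (-(a ^ 2 / (R ^ 2 + a ^ 2 * c ^ 2))) * (1 / (1 - c ^ 2) - 2 * a ^ 2 / (R ^ 2 +
        a ^ 2 * c ^ 2))) * hσ

end Algebra

theorem ricci_kerr (h : Regular a F F' F'' I) {x : Coords} (hx : x ∈ chart I) (m n : Fin 4) :
    ricci (kerr a F) m n x =
      (∑ l, (pd n (christoffel (kerr a F) l m l) x - pd l (christoffel (kerr a F) l m n) x)) +
        quad (kGam a (x 1) (sin (x 2)) (cos (x 2)) (F (x 1)) (F' (x 1))) m n := by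
  simp only [ricci, quad, christoffel_kerr h hx]

theorem ricci_tt (h : Regular a F F' F'' I) {x : Coords} (hx : x ∈ chart I) :
    ricci (kerr a F) 0 0 x =
      -(prs a (x 1) (cos (x 2)) (F (x 1)) (F' (x 1)) (F'' (x 1)) *
        (x 1 ^ 2 + a ^ 2 - F (x 1)) / (x 1 ^ 2 + a ^ 2 * cos (x 2) ^ 2)) -
      enr a (x 1) (cos (x 2)) (F (x 1)) (F' (x 1)) * a ^ 2 * (1 - cos (x 2) ^ 2) /
        (x 1 ^ 2 + a ^ 2 * cos (x 2) ^ 2) := by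
  have hS := (h.sig_pos hx.1 (cos (x 2))).ne'
  have hF := h.hasDerivAt _ hx.1
  have hF' := h.hasDerivAt' _ hx.1
  rw [ricci_kerr h hx, ← ricci_alg_tt hS (h.del_pos _ hx.1).ne' (one_sub_cos_sq_ne hx.2)
    (sin_sq (x 2))]
  have e1 : deriv (fun r => kGam a r (sin (x 2)) (cos (x 2)) (F r) (F' r) 1 0 0) (x 1) = _ :=
    (hasDerivAt_B hS hF hF').neg.deriv
  have e2 : deriv (fun t => kGam a (x 1) (sin t) (cos t) (F (x 1)) (F' (x 1)) 2 0 0) (x 2) = _ :=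
    ((hasDerivAt_K hS 3).const_mul (a ^ 2 * F (x 1))).neg.deriv
  simp only [Fin.sum_univ_four, pd_christoffel_kerr h hx, vec4_apply, e1, e2]
  ring

theorem ricci_tφ_eq (h : Regular a F F' F'' I) {x : Coords} (hx : x ∈ chart I) :
    ricci (kerr a F) 3 0 x = ricci (kerr a F) 0 3 x := by
  rw [ricci_kerr h hx, ricci_kerr h hx, kGam, quad_φt]
  congr 1
  simp only [Fin.sum_univ_four, pd_christoffel_kerr h hx, vec4_apply]
  rfl

theorem ricci_tφ (h : Regular a F F' F'' I) {x : Coords} (hx : x ∈ chart I) :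
    ricci (kerr a F) 0 3 x =
      prs a (x 1) (cos (x 2)) (F (x 1)) (F' (x 1)) (F'' (x 1)) *
        (x 1 ^ 2 + a ^ 2 - F (x 1)) * a * (1 - cos (x 2) ^ 2) /
          (x 1 ^ 2 + a ^ 2 * cos (x 2) ^ 2) +
      enr a (x 1) (cos (x 2)) (F (x 1)) (F' (x 1)) * a * (1 - cos (x 2) ^ 2) *
        (x 1 ^ 2 + a ^ 2) / (x 1 ^ 2 + a ^ 2 * cos (x 2) ^ 2) := by
  have hS := (h.sig_pos hx.1 (cos (x 2))).ne'
  have hF := h.hasDerivAt _ hx.1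
  have hF' := h.hasDerivAt' _ hx.1
  rw [ricci_kerr h hx, ← ricci_alg_tφ hS (h.del_pos _ hx.1).ne' (one_sub_cos_sq_ne hx.2)
    (sin_sq (x 2))]
  have e1 : deriv (fun r => kGam a r (sin (x 2)) (cos (x 2)) (F r) (F' r) 1 0 3) (x 1) = _ :=
    ((hasDerivAt_B hS hF hF').const_mul (a * (1 - cos (x 2) ^ 2))).deriv
  have e2 : deriv (fun t => kGam a (x 1) (sin t) (cos t) (F (x 1)) (F' (x 1)) 2 0 3) (x 2) = _ :=
    ((hasDerivAt_K hS 3).const_mul (a * F (x 1) * (x 1 ^ 2 + a ^ 2))).deriv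
  simp only [Fin.sum_univ_four, pd_christoffel_kerr h hx, vec4_apply, e1, e2]
  ring

theorem ricci_φφ (h : Regular a F F' F'' I) {x : Coords} (hx : x ∈ chart I) :
    ricci (kerr a F) 3 3 x =
      -(prs a (x 1) (cos (x 2)) (F (x 1)) (F' (x 1)) (F'' (x 1)) *
        (x 1 ^ 2 + a ^ 2 - F (x 1)) * a ^ 2 * (1 - cos (x 2) ^ 2) ^ 2 /
          (x 1 ^ 2 + a ^ 2 * cos (x 2) ^ 2)) -
      enr a (x 1) (cos (x 2)) (F (x 1)) (F' (x 1)) * (1 - cos (x 2) ^ 2) *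
        (x 1 ^ 2 + a ^ 2) ^ 2 / (x 1 ^ 2 + a ^ 2 * cos (x 2) ^ 2) := by
  have hS := (h.sig_pos hx.1 (cos (x 2))).ne'
  have hF := h.hasDerivAt _ hx.1
  have hF' := h.hasDerivAt' _ hx.1
  rw [ricci_kerr h hx, ← ricci_alg_φφ hS (h.del_pos _ hx.1).ne' (one_sub_cos_sq_ne hx.2)
    (sin_sq (x 2))]
  have e1 : deriv (fun r => kGam a r (sin (x 2)) (cos (x 2)) (F r) (F' r) 1 3 3) (x 1) = _ :=
    (((hasDerivAt_A hS hF).const_mul (1 - cos (x 2) ^ 2)).add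
      ((hasDerivAt_B hS hF hF').const_mul (a ^ 2 * (1 - cos (x 2) ^ 2) ^ 2))).neg.deriv
  have e2 : deriv (fun t => kGam a (x 1) (sin t) (cos t) (F (x 1)) (F' (x 1)) 2 3 3) (x 2) = _ :=
    ((((hasDerivAt_K_one hS).const_mul (x 1 ^ 2 + a ^ 2)).add
      ((hasDerivAt_mul_K hS 2).const_mul (2 * a ^ 2 * F (x 1)))).add
      ((hasDerivAt_sq_mul_K hS 3).const_mul (a ^ 4 * F (x 1)))).neg.deriv
  simp only [Fin.sum_univ_four, pd_christoffel_kerr h hx, vec4_apply, e1, e2]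
  ring

theorem ricci_RR (h : Regular a F F' F'' I) {x : Coords} (hx : x ∈ chart I) :
    ricci (kerr a F) 1 1 x =
      prs a (x 1) (cos (x 2)) (F (x 1)) (F' (x 1)) (F'' (x 1)) *
        (x 1 ^ 2 + a ^ 2 * cos (x 2) ^ 2) / (x 1 ^ 2 + a ^ 2 - F (x 1)) := by
  have hS := (h.sig_pos hx.1 (cos (x 2))).ne'
  have hD := (h.del_pos _ hx.1).ne'
  have hF := h.hasDerivAt _ hx.1
  have hF' := h.hasDerivAt' _ hx.1
  rw [ricci_kerr h hx, ← ricci_alg_RR hS hD (one_sub_cos_sq_ne hx.2) (sin_sq (x 2))]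
  have hR := hasDerivAt_sig_R a 1 (x 1)
  simp only [one_pow, mul_one] at hR
  have hE := hasDerivAt_E hS hD hF hF'
  have hQ := hasDerivAt_Q (a := a) (c := cos (x 2)) hS
  have e1 : deriv (fun r => kGam a r (sin (x 2)) (cos (x 2)) (F r) (F' r) 0 1 0) (x 1) = _ :=
    (hR.mul hE).neg.deriv
  have e2 : deriv (fun r => kGam a r (sin (x 2)) (cos (x 2)) (F r) (F' r) 2 1 2) (x 1) = _ :=
    hQ.deriv
  have e3 : deriv (fun r => kGam a r (sin (x 2)) (cos (x 2)) (F r) (F' r) 3 1 3) (x 1) = _ :=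
    (((hE.const_mul (a ^ 2 * (1 - cos (x 2) ^ 2))).add hQ).sub
      ((hasDerivAt_U hS hD hF).const_mul (a ^ 2 * (1 - cos (x 2) ^ 2)))).deriv
  have e4 : deriv (fun t => kGam a (x 1) (sin t) (cos t) (F (x 1)) (F' (x 1)) 2 1 1) (x 2) = _ :=
    ((hasDerivAt_K_one hS).const_mul (a ^ 2 / (x 1 ^ 2 + a ^ 2 - F (x 1)))).deriv
  -- `∂_R Γ^R_RR` occurs with both signs, so `sub_self` removes it and its value is never needed.
  simp only [Fin.sum_univ_four, pd_christoffel_kerr h hx, vec4_apply, e1, e2, e3, e4, sub_self]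
  ring

theorem ricci_θθ (h : Regular a F F' F'' I) {x : Coords} (hx : x ∈ chart I) :
    ricci (kerr a F) 2 2 x =
      -(enr a (x 1) (cos (x 2)) (F (x 1)) (F' (x 1)) *
        (x 1 ^ 2 + a ^ 2 * cos (x 2) ^ 2)) := by
  have hS := (h.sig_pos hx.1 (cos (x 2))).ne'
  have hD := (h.del_pos _ hx.1).ne'
  have hF := h.hasDerivAt _ hx.1
  rw [ricci_kerr h hx, ← ricci_alg_θθ hS hD (one_sub_cos_sq_ne hx.2) (sin_sq (x 2))]
  have hK := hasDerivAt_K hS 2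
  have e1 : deriv (fun t => kGam a (x 1) (sin t) (cos t) (F (x 1)) (F' (x 1)) 0 2 0) (x 2) = _ :=
    (hK.const_mul (a ^ 2 * F (x 1))).neg.deriv
  have e2 : deriv (fun t => kGam a (x 1) (sin t) (cos t) (F (x 1)) (F' (x 1)) 1 2 1) (x 2) = _ :=
    ((hasDerivAt_K_one hS).const_mul (a ^ 2)).neg.deriv
  have e3 : deriv (fun t => kGam a (x 1) (sin t) (cos t) (F (x 1)) (F' (x 1)) 3 2 3) (x 2) = _ :=
    ((hasDerivAt_cot hx.2).add (hK.const_mul (a ^ 2 * F (x 1)))).deriv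
  have e4 : deriv (fun r => kGam a r (sin (x 2)) (cos (x 2)) (F r) (F' r) 1 2 2) (x 1) = _ :=
    (hasDerivAt_A hS hF).neg.deriv
  simp only [Fin.sum_univ_four, pd_christoffel_kerr h hx, vec4_apply, e1, e2, e3, e4, sub_self]
  ring

/-! ### The Einstein tensor -/

/-- The inverse metric has only diagonal and `tφ` entries, so the remaining Ricci components do not
enter the trace. -/
theorem scalarCurvature_kerr (h : Regular a F F' F'' I) {x : Coords} (hx : x ∈ chart I) :
    scalarCurvature (kerr a F) x =
      2 * (enr a (x 1) (cos (x 2)) (F (x 1)) (F' (x 1)) -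
        prs a (x 1) (cos (x 2)) (F (x 1)) (F' (x 1)) (F'' (x 1))) := by
  have hS := (h.sig_pos hx.1 (cos (x 2))).ne'
  have hD := (h.del_pos _ hx.1).ne'
  have hw := one_sub_cos_sq_ne hx.2
  rw [scalarCurvature, kerr, kg_inv hS hD hw, kgInv]
  simp only [Fin.sum_univ_four, blk_apply, ricci_tt h hx, ricci_tφ_eq h hx, ricci_tφ h hx,
    ricci_φφ h hx, ricci_RR h hx, ricci_θθ h hx, zero_mul, add_zero, zero_add]
  generalize enr a (x 1) (cos (x 2)) (F (x 1)) (F' (x 1)) = e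
  generalize prs a (x 1) (cos (x 2)) (F (x 1)) (F' (x 1)) (F'' (x 1)) = q
  generalize F (x 1) = f at *
  generalize cos (x 2) = c at *
  generalize x 1 = R at *
  field_simp
  ring

theorem einstein_tt (h : Regular a F F' F'' I) {x : Coords} (hx : x ∈ chart I) :
    einstein (kerr a F) 0 0 x =
      -(enr a (x 1) (cos (x 2)) (F (x 1)) (F' (x 1)) * (x 1 ^ 2 + a ^ 2 - F (x 1)) /
        (x 1 ^ 2 + a ^ 2 * cos (x 2) ^ 2)) -
      prs a (x 1) (cos (x 2)) (F (x 1)) (F' (x 1)) (F'' (x 1)) * a ^ 2 * (1 - cos (x 2) ^ 2) /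
        (x 1 ^ 2 + a ^ 2 * cos (x 2) ^ 2) := by
  have hS := (h.sig_pos hx.1 (cos (x 2))).ne'
  have e : kerr a F x 0 0 = 1 - F (x 1) / (x 1 ^ 2 + a ^ 2 * cos (x 2) ^ 2) := rfl
  rw [einstein, scalarCurvature_kerr h hx, ricci_tt h hx, e]
  field_simp
  ring

theorem einstein_RR (h : Regular a F F' F'' I) {x : Coords} (hx : x ∈ chart I) :
    einstein (kerr a F) 1 1 x =
      enr a (x 1) (cos (x 2)) (F (x 1)) (F' (x 1)) *
        (x 1 ^ 2 + a ^ 2 * cos (x 2) ^ 2) / (x 1 ^ 2 + a ^ 2 - F (x 1)) := by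
  have hS := (h.sig_pos hx.1 (cos (x 2))).ne'
  have hD := (h.del_pos _ hx.1).ne'
  have e : kerr a F x 1 1 =
    -((x 1 ^ 2 + a ^ 2 * cos (x 2) ^ 2) / (x 1 ^ 2 + a ^ 2 - F (x 1))) := rfl
  rw [einstein, scalarCurvature_kerr h hx, ricci_RR h hx, e]
  field_simp
  ring

/-! ### The energy-momentum tensor -/

theorem metric_eq_kerr (a : ℝ) (M : ℝ → ℝ) : metric a M = kerr a (fun R => 2 * R * M R) := by
  funext x
  have e : metric a M x = blk (1 - 2 * x 1 * M (x 1) / Sig a (x 1) (x 2))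
      (2 * a * x 1 * M (x 1) / Sig a (x 1) (x 2) * sin (x 2) ^ 2)
      (-(Sig a (x 1) (x 2) / Del a M (x 1))) 0 (-Sig a (x 1) (x 2))
      (-(sin (x 2) ^ 2 / Sig a (x 1) (x 2) *
        ((x 1 ^ 2 + a ^ 2) ^ 2 - a ^ 2 * sin (x 2) ^ 2 * Del a M (x 1)))) := rfl
  rw [e, kerr, kg]
  refine blk_congr ?_ ?_ ?_ ?_ ?_ ?_ <;> simp only [Sig, Del, sin_sq] <;> ring

theorem stress_eq (a : ℝ) (M ρG : ℝ → ℝ) (m n : Fin 4) (x : Coords) :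
    stress a M ρG m n x =
      (density a ρG x + tangentialPressure a ρG x) *
        (lower (metric a M x) (fourVelocity a M x) m * lower (metric a M x) (fourVelocity a M x) n -
          lower (metric a M x) (radialVector a M x) m *
            lower (metric a M x) (radialVector a M x) n) -
        tangentialPressure a ρG x * metric a M x m n := by
  have h : ∑ k, metric a M x m k * (if k = n then 1 else 0) = metric a M x m n := by simp
  rw [← h]
  simp only [stress, stressMixed]
  -- The factors carrying the free index `n` are common to both sides; only the contraction over `k`
  -- has to be expanded.
  generalize hu : lower (metric a M x) (fourVelocity a M x) n = un
  generalize hl : lower (metric a M x) (radialVector a M x) n = ln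
  simp only [lower, Fin.sum_univ_four]
  ring

section Frame

variable {a : ℝ} {M : ℝ → ℝ} {x : Coords}

/-- The key identity is `g_tt + Ω g_tφ = Δ/A`. A unit vector along `∂_t + Ω∂_φ` would give `Δ/Σ`
here; the extra factor `Δ²/A²` is the source of the contradiction. -/
theorem lower_fourVelocity_zero (hS : 0 < Sig a (x 1) (x 2)) (hR : 0 < x 1)
    (hD : 0 < Del a M (x 1)) (hs : sin (x 2) ≠ 0) :
    lower (metric a M x) (fourVelocity a M x) 0 ^ 2 =
      Del a M (x 1) ^ 3 / (Sig a (x 1) (x 2) * (x 1 ^ 2 + a ^ 2) ^ 2) := by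
  have hS' : x 1 ^ 2 + a ^ 2 * cos (x 2) ^ 2 ≠ 0 := hS.ne'
  have eD : x 1 ^ 2 + a ^ 2 - 2 * x 1 * M (x 1) = Del a M (x 1) := by rw [Del]; ring
  have hD' : x 1 ^ 2 + a ^ 2 - 2 * x 1 * M (x 1) ≠ 0 := eD ▸ hD.ne'
  have hinv : (metric a M x)⁻¹ 1 1 = -(Del a M (x 1) / Sig a (x 1) (x 2)) := by
    rw [metric_eq_kerr, kerr, kg_inv hS' hD' (one_sub_cos_sq_ne hs), ← eD]
    rfl
  have h0 : metric a M x 0 0 = 1 - 2 * x 1 * M (x 1) / Sig a (x 1) (x 2) := rfl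
  have h3 : metric a M x 0 3 =
    2 * a * x 1 * M (x 1) / Sig a (x 1) (x 2) * sin (x 2) ^ 2 := rfl
  have hu : lower (metric a M x) (fourVelocity a M x) 0 =
      sqrt (Del a M (x 1) / Sig a (x 1) (x 2)) *
        (metric a M x 0 0 + Om a (x 1) * metric a M x 0 3) := by
    rw [lower, fourVelocity, hinv, neg_neg]
    simp [Fin.sum_univ_four]
    ring
  have hR' : x 1 ^ 2 + a ^ 2 ≠ 0 := by positivity
  have h : metric a M x 0 0 + Om a (x 1) * metric a M x 0 3 =
      Del a M (x 1) / (x 1 ^ 2 + a ^ 2) := by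
    rw [h0, h3, Om, Del, Sig, sin_sq]
    field_simp
    ring
  rw [hu, h, mul_pow, sq_sqrt (div_pos hD hS).le]
  field_simp

theorem lower_radialVector_zero : lower (metric a M x) (radialVector a M x) 0 = 0 := by
  have h : metric a M x 0 1 = 0 := rfl
  simp [lower, radialVector, Fin.sum_univ_four, h]

theorem lower_fourVelocity_one : lower (metric a M x) (fourVelocity a M x) 1 = 0 := by
  have h0 : metric a M x 1 0 = 0 := rfl
  have h3 : metric a M x 1 3 = 0 := rfl
  simp [lower, fourVelocity, Fin.sum_univ_four, h0, h3]

theorem lower_radialVector_one (hS : 0 < Sig a (x 1) (x 2)) (hD : 0 < Del a M (x 1)) :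
    lower (metric a M x) (radialVector a M x) 1 ^ 2 = Sig a (x 1) (x 2) / Del a M (x 1) := by
  have h : metric a M x 1 1 = -(Sig a (x 1) (x 2) / Del a M (x 1)) := rfl
  have hq := div_pos hS hD
  generalize Sig a (x 1) (x 2) / Del a M (x 1) = q at h hq
  have e : lower (metric a M x) (radialVector a M x) 1 = q / sqrt q := by
    simp [lower, radialVector, Fin.sum_univ_four, h, div_eq_mul_inv]
  rw [e, div_pow, sq_sqrt hq.le]
  field_simp

theorem stress_tt (ρG : ℝ → ℝ) (hS : 0 < Sig a (x 1) (x 2)) (hR : 0 < x 1)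
    (hD : 0 < Del a M (x 1)) (hs : sin (x 2) ≠ 0) :
    stress a M ρG 0 0 x = (density a ρG x + tangentialPressure a ρG x) *
        (Del a M (x 1) ^ 3 / (Sig a (x 1) (x 2) * (x 1 ^ 2 + a ^ 2) ^ 2)) -
      tangentialPressure a ρG x * (1 - 2 * x 1 * M (x 1) / Sig a (x 1) (x 2)) := by
  rw [stress_eq, ← lower_fourVelocity_zero hS hR hD hs, lower_radialVector_zero,
    show metric a M x 0 0 = 1 - 2 * x 1 * M (x 1) / Sig a (x 1) (x 2) from rfl]
  ring

/-- Since `ℓ_R² = -g_RR`, the tangential pressure cancels. -/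
theorem stress_RR (ρG : ℝ → ℝ) (hS : 0 < Sig a (x 1) (x 2)) (hD : 0 < Del a M (x 1)) :
    stress a M ρG 1 1 x = -(density a ρG x * (Sig a (x 1) (x 2) / Del a M (x 1))) := by
  rw [stress_eq, lower_fourVelocity_one, ← sq, ← sq, lower_radialVector_one hS hD,
    show metric a M x 1 1 = -(Sig a (x 1) (x 2) / Del a M (x 1)) from rfl]
  ring

/-- The left-hand side of the equation for `ρ_G` that the field equations imply. -/
def transport (a θ : ℝ) (ρG : ℝ → ℝ) (R : ℝ) : ℝ :=
  deriv ρG R + 4 * a ^ 2 * cos θ ^ 2 / (R * Sig a R θ) * ρG R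

theorem density_add_tangentialPressure {ρG : ℝ → ℝ} (hS : 0 < Sig a (x 1) (x 2)) (hR : 0 < x 1)
    (hρ : DifferentiableAt ℝ ρG (x 1)) :
    density a ρG x + tangentialPressure a ρG x =
      -(x 1 ^ 3 / (2 * Sig a (x 1) (x 2)) * transport a (x 2) ρG (x 1)) := by
  have hS' : x 1 ^ 2 + a ^ 2 * cos (x 2) ^ 2 ≠ 0 := hS.ne'
  have h : HasDerivAt (fun r => r ^ 4 / (r ^ 2 + a ^ 2 * cos (x 2) ^ 2) ^ 2 * ρG r) _ (x 1) :=
    ((hasDerivAt_pow 4 (x 1)).div ((hasDerivAt_sig_R a (cos (x 2)) (x 1)).pow 2)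
      (pow_ne_zero 2 hS')).mul hρ.hasDerivAt
  have e : pd 1 (density a ρG) x = _ :=
    (pd_comp 1 (fun r t => r ^ 4 / (r ^ 2 + a ^ 2 * cos t ^ 2) ^ 2 * ρG r) x).trans h.deriv
  rw [tangentialPressure, e]
  simp only [density, transport, Sig, Pi.div_apply, Pi.pow_apply]
  field_simp
  ring

end Frame

/-! ### Consequences of the field equations -/

theorem regular_of_contDiffOn {a : ℝ} {M : ℝ → ℝ} {I : Set ℝ} (hI : IsOpen I)
    (hpos : I ⊆ Set.Ioi 0) (hM : ContDiffOn ℝ 2 M I) (hD : ∀ R ∈ I, 0 < Del a M R) :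
    Regular a (fun R => 2 * R * M R) (fun R => 2 * M R + 2 * R * deriv M R)
      (fun R => 4 * deriv M R + 2 * R * deriv (deriv M) R) I := by
  have h1 : ContDiffOn ℝ 1 (deriv M) I := hM.deriv_of_isOpen hI (by norm_num)
  have d0 : ∀ R ∈ I, HasDerivAt M (deriv M R) R := fun R hR =>
    ((hM.differentiableOn (by norm_num)).differentiableAt (hI.mem_nhds hR)).hasDerivAt
  have d1 : ∀ R ∈ I, HasDerivAt (deriv M) (deriv (deriv M) R) R := fun R hR =>
    ((h1.differentiableOn (by norm_num)).differentiableAt (hI.mem_nhds hR)).hasDerivAt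
  refine ⟨hI, fun R hR => hpos hR, fun R hR => ?_, fun R hR => ?_, fun R hR => ?_⟩
  · have := hD R hR
    rw [Del] at this
    linarith
  · refine (((hasDerivAt_id R).const_mul 2).mul (d0 R hR)).congr_deriv ?_
    simp
  · refine (((d0 R hR).const_mul 2).add
      (((hasDerivAt_id R).const_mul 2).mul (d1 R hR))).congr_deriv ?_
    simp
    ring

section Core

variable {a θ : ℝ} {M ρG : ℝ → ℝ} {I : Set ℝ}

theorem deriv_mass_of_fieldEqs (hI : IsOpen I) (hpos : I ⊆ Set.Ioi 0) (hM : ContDiffOn ℝ 2 M I)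
    (hD : ∀ R ∈ I, 0 < Del a M R) (hθ : sin θ ≠ 0)
    (hE : ∀ x : Coords, x 1 ∈ I → x 2 = θ → FieldEqs a M ρG x) {R : ℝ} (hR : R ∈ I) :
    deriv M R = 4 * π * R ^ 2 * ρG R := by
  have hreg := regular_of_contDiffOn hI hpos hM hD
  have hR0 : 0 < R := hpos hR
  have hS := hreg.sig_pos hR (cos θ)
  have hDR := hD R hR
  set x : Coords := ![0, R, θ, 0] with hx
  have hT := stress_RR (a := a) (M := M) (x := x) ρG hS hDR
  have h := (hE x hR rfl).2
  rw [hT, metric_eq_kerr, einstein_RR hreg (x := x) ⟨hR, hθ⟩] at h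
  have hDe : R ^ 2 + a ^ 2 - 2 * R * M R = Del a M R := by rw [Del]; ring
  simp only [hx, density, enr, Sig, Matrix.cons_val_one, Matrix.cons_val_zero, Matrix.cons_val,
    hDe] at h
  field_simp at h
  have h0 : R * (deriv M R - 4 * π * R ^ 2 * ρG R) = 0 := by linear_combination h / 2
  exact sub_eq_zero.1 ((mul_eq_zero.1 h0).resolve_left hR0.ne')

theorem transport_eq_zero_or_mass_eq_zero (hI : IsOpen I) (hpos : I ⊆ Set.Ioi 0)
    (hM : ContDiffOn ℝ 2 M I) (hρ : DifferentiableOn ℝ ρG I)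
    (hD : ∀ R ∈ I, 0 < Del a M R) (hθ : sin θ ≠ 0)
    (hE : ∀ x : Coords, x 1 ∈ I → x 2 = θ → FieldEqs a M ρG x) {R : ℝ} (hR : R ∈ I) :
    transport a θ ρG R = 0 ∨ M R = 0 := by
  have hreg := regular_of_contDiffOn hI hpos hM hD
  have hR0 : 0 < R := hpos hR
  have hS := hreg.sig_pos hR (cos θ)
  have hDR := hD R hR
  have hρR := hρ.differentiableAt (hI.mem_nhds hR)
  have hM1 := deriv_mass_of_fieldEqs hI hpos hM hD hθ hE hR
  have hM2 : deriv (deriv M) R = 4 * π * (2 * R * ρG R + R ^ 2 * deriv ρG R) := by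
    have e : deriv M =ᶠ[nhds R] fun r => 4 * π * r ^ 2 * ρG r :=
      Filter.eventually_of_mem (hI.mem_nhds hR) fun r hr =>
        deriv_mass_of_fieldEqs hI hpos hM hD hθ hE hr
    rw [e.deriv_eq]
    refine ((((hasDerivAt_pow 2 R).const_mul (4 * π)).mul hρR.hasDerivAt).congr_deriv ?_).deriv
    simp
    ring
  set x : Coords := ![0, R, θ, 0] with hx
  have hP := density_add_tangentialPressure (a := a) (x := x) hS hR0 hρR
  have hT := stress_tt (a := a) (M := M) (x := x) ρG hS hR0 hDR hθ
  have h := (hE x hR rfl).1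
  rw [hT, metric_eq_kerr, einstein_tt hreg (x := x) ⟨hR, hθ⟩] at h
  have hp : tangentialPressure a ρG x =
    -(x 1 ^ 3 / (2 * Sig a (x 1) (x 2)) * transport a (x 2) ρG (x 1)) - density a ρG x := by
    linarith
  rw [hP, hp] at h
  have hDe : 2 * R * M R = R ^ 2 + a ^ 2 - Del a M R := by rw [Del]; ring
  -- Trading `ρ_G'` for `transport` makes `transport` the unknown `K`; the terms in `ρ_G` alone then
  -- cancel.
  have hk : deriv ρG R = transport a θ ρG R - 4 * a ^ 2 * cos θ ^ 2 / (R * Sig a R θ) * ρG R := by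
    rw [transport]; ring
  have hF : R * (2 * M R + 2 * R * deriv M R) - 2 * R * M R = 8 * π * R ^ 4 * ρG R := by
    rw [hM1]; ring
  have hF2 : 4 * deriv M R + 2 * R * deriv (deriv M) R =
      8 * π * (4 * R ^ 2 * ρG R + R ^ 3 * (transport a θ ρG R -
        4 * a ^ 2 * cos θ ^ 2 / (R * Sig a R θ) * ρG R)) := by
    rw [hM2, hM1, ← hk]; ring
  simp only [hx, density, enr, prs, Matrix.cons_val_one, Matrix.cons_val_zero,
    Matrix.cons_val] at h
  rw [hF, hF2, hDe] at h
  simp only [Sig] at h hS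
  generalize transport a θ ρG R = K at *
  generalize Del a M R = D at *
  generalize ρG R = r at *
  generalize cos θ = c at *
  have hA : 0 < R ^ 2 + a ^ 2 := by positivity
  have key : K * (D ^ 2 - (R ^ 2 + a ^ 2) ^ 2) = 0 := by
    have hA' := hA.ne'
    have hS' := hS.ne'
    have hD' := hDR.ne'
    have hπ := pi_ne_zero
    -- The difference of the two sides of `h` is `4πR³ΔK(A² - Δ²)/(Σ²A²)`.
    linear_combination (norm := (field_simp; ring))
      (-((R ^ 2 + a ^ 2 * c ^ 2) ^ 2 * (R ^ 2 + a ^ 2) ^ 2) / (4 * π * R ^ 3 * D)) * h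
  rcases mul_eq_zero.1 key with h0 | h0
  · exact Or.inl h0
  · right
    have : D = R ^ 2 + a ^ 2 := by
      rwa [sub_eq_zero, sq_eq_sq₀ hDR.le hA.le] at h0
    rw [this, sub_self] at hDe
    simpa [hR0.ne'] using hDe

theorem transport_eq_zero (hI : IsOpen I) (hpos : I ⊆ Set.Ioi 0)
    (hM : ContDiffOn ℝ 2 M I) (hρ : DifferentiableOn ℝ ρG I)
    (hD : ∀ R ∈ I, 0 < Del a M R) (hθ : sin θ ≠ 0)
    (hE : ∀ x : Coords, x 1 ∈ I → x 2 = θ → FieldEqs a M ρG x) {R : ℝ} (hR : R ∈ I) :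
    transport a θ ρG R = 0 := by
  by_contra hK
  have hn := hI.mem_nhds hR
  have hm : ∀ r ∈ I, deriv M r = 4 * π * r ^ 2 * ρG r := fun r hr =>
    deriv_mass_of_fieldEqs hI hpos hM hD hθ hE hr
  have hr0 : ∀ r ∈ I, 4 * π * r ^ 2 ≠ 0 := fun r hr => by
    have : 0 < r := hpos hr
    positivity
  -- `ρ_G` is only assumed differentiable, but `ρ_G = M'/(4πr²)` with `M` of class `C²` makes it
  -- `C¹`, so `transport` is continuous.
  have h1 : ContDiffOn ℝ 1 ρG I := by
    refine ((hM.deriv_of_isOpen (m := 1) hI (by norm_num)).div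
      (g := fun r => 4 * π * r ^ 2) (by fun_prop) hr0).congr fun r hr => ?_
    rw [Pi.div_apply, hm r hr, mul_div_cancel_left₀ _ (hr0 r hr)]
  have hc : ContinuousAt (transport a θ ρG) R := by
    have hR0 : 0 < R := hpos hR
    have hS : R * (R ^ 2 + a ^ 2 * cos θ ^ 2) ≠ 0 := by positivity
    have hd : ContinuousAt (deriv ρG) R :=
      (h1.continuousOn_deriv_of_isOpen hI le_rfl).continuousAt hn
    have hρc : ContinuousAt ρG R := (h1.continuousOn).continuousAt hn
    have hk : ContinuousAt
        (fun r => 4 * a ^ 2 * cos θ ^ 2 / (r * (r ^ 2 + a ^ 2 * cos θ ^ 2))) R :=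
      ContinuousAt.div (by fun_prop) (by fun_prop) hS
    exact hd.add (hk.mul hρc)
  have hM0 : ∀ᶠ r in nhds R, r ∈ I ∧ M r = 0 := by
    filter_upwards [hc.eventually_ne hK, hn] with r hr hrI
    exact ⟨hrI, (transport_eq_zero_or_mass_eq_zero hI hpos hM hρ hD hθ hE hrI).resolve_left hr⟩
  have hρ0 : ρG =ᶠ[nhds R] fun _ => 0 := by
    -- To get `M' = 0` at `r`, the function `M` must vanish on a whole neighbourhood of `r`, not
    -- just at `r`.
    filter_upwards [hM0.eventually_nhds] with r hr
    have e : M =ᶠ[nhds r] fun _ => 0 := hr.mono fun s hs => hs.2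
    have hrI := hr.self_of_nhds.1
    have h := hm r hrI
    rw [e.deriv_eq, deriv_const] at h
    exact (mul_eq_zero.1 h.symm).resolve_left (hr0 r hrI)
  apply hK
  rw [transport, hρ0.deriv_eq, hρ0.eq_of_nhds, deriv_const]
  simp

end Core

/-- If `cos²` were constant on `J`, its derivative would force `cos = 0` on `J` because `sin ≠ 0`
there; differentiating once more would give `sin = 0`. -/
theorem exists_cos_sq_ne {J : Set ℝ} (hJ : IsOpen J) (hne : J.Nonempty)
    (hs : J ⊆ Set.Ioo 0 π) : ∃ θ₁ ∈ J, ∃ θ₂ ∈ J, cos θ₁ ^ 2 ≠ cos θ₂ ^ 2 := by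
  by_contra! hcon
  have hsin : ∀ θ ∈ J, sin θ ≠ 0 := fun θ hθ => (sin_pos_of_mem_Ioo (hs hθ)).ne'
  have hcos : ∀ θ ∈ J, cos θ = 0 := fun θ hθ => by
    have e : (fun t => 1 - cos t ^ 2) =ᶠ[nhds θ] fun _ => 1 - cos θ ^ 2 :=
      Filter.eventually_of_mem (hJ.mem_nhds hθ) fun t ht => by
        simp only [hcon t ht θ hθ]
    have h := (hasDerivAt_one_sub_cos_sq θ).deriv
    rw [e.deriv_eq, deriv_const] at h
    simpa [hsin θ hθ] using h.symm
  obtain ⟨θ, hθ⟩ := hne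
  have e : cos =ᶠ[nhds θ] fun _ => 0 := Filter.eventually_of_mem (hJ.mem_nhds hθ) hcos
  have h := (hasDerivAt_cos θ).deriv
  rw [e.deriv_eq, deriv_const] at h
  exact hsin θ hθ (by linarith)

theorem not_fieldEqs_of_ne_zero {a : ℝ} {M ρG : ℝ → ℝ} {I J : Set ℝ} (ha : a ≠ 0)
    (hI : IsOpen I) (hpos : I ⊆ Set.Ioi 0) (hM : ContDiffOn ℝ 2 M I)
    (hρ : DifferentiableOn ℝ ρG I) (hD : ∀ R ∈ I, 0 < Del a M R)
    (hne : ∃ R ∈ I, ρG R ≠ 0) (hJ : IsOpen J) (hJne : J.Nonempty) (hJs : J ⊆ Set.Ioo 0 π) :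
    ¬ ∀ x : Coords, x 1 ∈ I → x 2 ∈ J → FieldEqs a M ρG x := by
  intro hE
  obtain ⟨R, hR, hρR⟩ := hne
  obtain ⟨θ₁, h₁, θ₂, h₂, hc⟩ := exists_cos_sq_ne hJ hJne hJs
  have hK : ∀ θ ∈ J, transport a θ ρG R = 0 := fun θ hθ =>
    transport_eq_zero hI hpos hM hρ hD (sin_pos_of_mem_Ioo (hJs hθ)).ne'
      (fun x hx hx2 => hE x hx (hx2 ▸ hθ)) hR
  have hR0 : 0 < R := hpos hR
  have e : transport a θ₁ ρG R = transport a θ₂ ρG R := by rw [hK θ₁ h₁, hK θ₂ h₂]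
  simp only [transport, Sig, add_right_inj] at e
  have e' := mul_right_cancel₀ hρR e
  have p₁ : 0 < R ^ 2 + a ^ 2 * cos θ₁ ^ 2 := by positivity
  have p₂ : 0 < R ^ 2 + a ^ 2 * cos θ₂ ^ 2 := by positivity
  rw [div_eq_div_iff (by positivity) (by positivity)] at e'
  apply hc
  -- After cross-multiplication the terms in `cos²ϑ₁ cos²ϑ₂` cancel.
  have h0 : 4 * a ^ 2 * R ^ 3 * (cos θ₁ ^ 2 - cos θ₂ ^ 2) = 0 := by linear_combination e'
  have h4 : 4 * a ^ 2 * R ^ 3 ≠ 0 := by positivity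
  exact sub_eq_zero.1 ((mul_eq_zero.1 h0).resolve_left h4)

/-! ### The Gaussian profile -/

section Gaussian

variable {m l0 : ℝ}

theorem gaussianDensity_pos (hm : 0 < m) (hl : 0 < l0) (R : ℝ) : 0 < gaussianDensity m l0 R := by
  rw [gaussianDensity]
  positivity

theorem contDiff_gaussianDensity (m l0 : ℝ) {n : WithTop ℕ∞} :
    ContDiff ℝ n (gaussianDensity m l0) := by
  unfold gaussianDensity
  fun_prop

theorem hasDerivAt_gaussianDensity (hl : l0 ≠ 0) (R : ℝ) :
    HasDerivAt (gaussianDensity m l0) (-(R / (2 * l0 ^ 2)) * gaussianDensity m l0 R) R := by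
  have h : HasDerivAt (fun r : ℝ => -(r ^ 2) / (4 * l0 ^ 2)) (-(2 * R) / (4 * l0 ^ 2)) R := by
    simpa using ((hasDerivAt_pow 2 R).neg).div_const (4 * l0 ^ 2)
  refine (h.exp.const_mul (m / (8 * π ^ (3 / 2 : ℝ) * l0 ^ 3))).congr_deriv ?_
  rw [gaussianDensity]
  generalize m / (8 * π ^ (3 / 2 : ℝ) * l0 ^ 3) = k
  field_simp
  ring

theorem exists_gt_mem_of_isOpen {I : Set ℝ} (hI : IsOpen I) {R : ℝ} (hR : R ∈ I) :
    ∃ R' ∈ I, R < R' := by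
  have hI' : ∀ᶠ r in nhdsWithin R (Set.Ioi R), r ∈ I := nhdsWithin_le_nhds (hI.mem_nhds hR)
  obtain ⟨r, hr, hr'⟩ := (hI'.and self_mem_nhdsWithin).exists
  exact ⟨r, hr, hr'⟩

theorem not_fieldEqs_gaussian (hm : 0 < m) (hl : 0 < l0) {a : ℝ} {M : ℝ → ℝ} {I J : Set ℝ}
    (hI : IsOpen I) (hIne : I.Nonempty) (hpos : I ⊆ Set.Ioi 0) (hM : ContDiffOn ℝ 2 M I)
    (hD : ∀ R ∈ I, 0 < Del a M R) (hJne : J.Nonempty) (hJs : J ⊆ Set.Ioo 0 π) :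
    ¬ ∀ x : Coords, x 1 ∈ I → x 2 ∈ J → FieldEqs a M (gaussianDensity m l0) x := by
  intro hE
  obtain ⟨θ, hθ⟩ := hJne
  have hρ : DifferentiableOn ℝ (gaussianDensity m l0) I :=
    ((contDiff_gaussianDensity m l0 (n := 1)).differentiable (by norm_num)).differentiableOn
  have key : ∀ R ∈ I, R ^ 2 * (R ^ 2 + a ^ 2 * cos θ ^ 2) = 8 * l0 ^ 2 * (a ^ 2 * cos θ ^ 2) := by
    intro R hR
    have hR0 : 0 < R := hpos hR
    have h := transport_eq_zero hI hpos hM hρ hD (sin_pos_of_mem_Ioo (hJs hθ)).ne'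
      (fun x hx hx2 => hE x hx (hx2 ▸ hθ)) hR
    rw [transport, (hasDerivAt_gaussianDensity hl.ne' R).deriv, ← add_mul] at h
    have h' := (mul_eq_zero.1 h).resolve_right (gaussianDensity_pos hm hl R).ne'
    rw [Sig] at h'
    have hS : R ^ 2 + a ^ 2 * cos θ ^ 2 ≠ 0 := by positivity
    field_simp at h'
    linarith
  obtain ⟨R, hR⟩ := hIne
  obtain ⟨R', hR', hlt⟩ := exists_gt_mem_of_isOpen hI hR
  have hR0 : 0 < R := hpos hR
  -- Strict monotonicity comes from the `R⁴` term, so the cases `a = 0` and `cos ϑ = 0` need no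
  -- separate treatment.
  have h : R ^ 2 * (R ^ 2 + a ^ 2 * cos θ ^ 2) < R' ^ 2 * (R' ^ 2 + a ^ 2 * cos θ ^ 2) := by
    gcongr
  rw [key R hR, key R' hR'] at h
  exact lt_irrefl _ h

theorem hasDerivAt_kerrrMass (m l0 R : ℝ) :
    HasDerivAt (kerrrMass m l0) (4 * π * (R ^ 2 * gaussianDensity m l0 R)) R := by
  have hc : Continuous fun x => x ^ 2 * gaussianDensity m l0 x :=
    (continuous_pow 2).mul (contDiff_gaussianDensity m l0 (n := 0)).continuous
  exact (hc.integral_hasStrictDerivAt 0 R).hasDerivAt.const_mul (4 * π)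

theorem contDiff_kerrrMass (m l0 : ℝ) : ContDiff ℝ 2 (kerrrMass m l0) := by
  have h : deriv (kerrrMass m l0) = fun R => 4 * π * (R ^ 2 * gaussianDensity m l0 R) :=
    funext fun R => (hasDerivAt_kerrrMass m l0 R).deriv
  rw [show (2 : WithTop ℕ∞) = 1 + 1 by norm_num, contDiff_succ_iff_deriv, h]
  refine ⟨fun R => (hasDerivAt_kerrrMass m l0 R).differentiableAt, by simp, ?_⟩
  exact contDiff_const.mul ((contDiff_id.pow 2).mul (contDiff_gaussianDensity m l0))

/-- This keeps the final claim from being vacuous. As `M(0) = M'(0) = 0`, for small `R > 0` one has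
`M(R) < R/2`, so `2RM < R²`, even when `a = 0`. -/
theorem exists_del_kerrrMass_pos (a m l0 : ℝ) :
    ∃ R, 0 < R ∧ 0 < Del a (kerrrMass m l0) R := by
  have hd := hasDerivAt_kerrrMass m l0 0
  have h0 : kerrrMass m l0 0 = 0 := by simp [kerrrMass]
  rw [hasDerivAt_iff_tendsto_slope] at hd
  have hlt : ∀ᶠ R in nhdsWithin (0 : ℝ) (Set.Ioi 0), slope (kerrrMass m l0) 0 R < 1 / 2 := by
    refine (hd.mono_left (nhdsWithin_mono 0 fun x hx => ?_)).eventually_lt_const (by norm_num)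
    exact (Set.mem_Ioi.1 hx).ne'
  obtain ⟨R, hR, hR0⟩ := (hlt.and self_mem_nhdsWithin).exists
  have hR0' : 0 < R := hR0
  refine ⟨R, hR0', ?_⟩
  rw [slope_def_field, h0, sub_zero, sub_zero, div_lt_iff₀ hR0'] at hR
  rw [Del]
  nlinarith [sq_nonneg a, mul_pos hR0' (sub_pos.2 hR)]

theorem not_fieldEqs_kerrrMass (hm : 0 < m) (hl : 0 < l0) (a : ℝ) :
    ¬ ∀ x : Coords, 0 < x 1 → x 2 ∈ Set.Ioo 0 π → 0 < Del a (kerrrMass m l0) (x 1) →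
      FieldEqs a (kerrrMass m l0) (gaussianDensity m l0) x := by
  intro hE
  have hM := contDiff_kerrrMass m l0
  have hDc : Continuous (Del a (kerrrMass m l0)) := by
    have := hM.continuous
    unfold Del
    fun_prop
  refine not_fieldEqs_gaussian hm hl (a := a) (M := kerrrMass m l0)
    (I := {R | 0 < R ∧ 0 < Del a (kerrrMass m l0) R}) (J := Set.Ioo 0 π)
    (isOpen_Ioi.inter (isOpen_Ioi.preimage hDc)) (exists_del_kerrrMass_pos a m l0)
    (fun R hR => hR.1) hM.contDiffOn (fun R hR => hR.2) ⟨π / 2, ?_⟩ subset_rfl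
    (fun x hx hx2 => hE x hx.1 hx2 hx.2)
  constructor <;> linarith [pi_pos]

end Gaussian

end Kerrr

end

theorem mainTheorem4 (a : ℝ) :
    (∀ (M ρG : ℝ → ℝ) (I : Set ℝ), IsOpen I → I ⊆ Set.Ioi 0 →
      ContDiffOn ℝ 2 M I → DifferentiableOn ℝ ρG I → (∀ R ∈ I, 0 < Kerrr.Del a M R) →
      (∀ θ ∈ Set.Ioo 0 Real.pi,
        (∀ x : Kerrr.Coords, x 1 ∈ I → x 2 = θ → Kerrr.FieldEqs a M ρG x) →
        ∀ R ∈ I,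
          deriv ρG R + 4 * a ^ 2 * Real.cos θ ^ 2 / (R * Kerrr.Sig a R θ) * ρG R = 0) ∧
      (a ≠ 0 → (∃ R ∈ I, ρG R ≠ 0) →
        ∀ J : Set ℝ, IsOpen J → J.Nonempty → J ⊆ Set.Ioo 0 Real.pi →
          ¬ ∀ x : Kerrr.Coords, x 1 ∈ I → x 2 ∈ J → Kerrr.FieldEqs a M ρG x)) ∧
    (∀ m l0 : ℝ, 0 < m → 0 < l0 →
      (∀ (M : ℝ → ℝ) (I J : Set ℝ), IsOpen I → I.Nonempty → I ⊆ Set.Ioi 0 →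
        ContDiffOn ℝ 2 M I → (∀ R ∈ I, 0 < Kerrr.Del a M R) →
        IsOpen J → J.Nonempty → J ⊆ Set.Ioo 0 Real.pi →
        ¬ ∀ x : Kerrr.Coords, x 1 ∈ I → x 2 ∈ J →
          Kerrr.FieldEqs a M (Kerrr.gaussianDensity m l0) x) ∧
      ¬ ∀ x : Kerrr.Coords, 0 < x 1 → x 2 ∈ Set.Ioo 0 Real.pi →
          0 < Kerrr.Del a (Kerrr.kerrrMass m l0) (x 1) →
          Kerrr.FieldEqs a (Kerrr.kerrrMass m l0) (Kerrr.gaussianDensity m l0) x) := by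
  refine ⟨fun M ρG I hI hpos hM hρ hD => ⟨fun θ hθ hE R hR => ?_,
    fun ha hne J hJ hJne hJs => ?_⟩, fun m l0 hm hl => ⟨?_, ?_⟩⟩
  · exact Kerrr.transport_eq_zero hI hpos hM hρ hD (Real.sin_pos_of_mem_Ioo hθ).ne' hE hR
  · exact Kerrr.not_fieldEqs_of_ne_zero ha hI hpos hM hρ hD hne hJ hJne hJs
  · intro M I J hI hIne hpos hM hD _ hJne hJs
    exact Kerrr.not_fieldEqs_gaussian hm hl hI hIne hpos hM hD hJne hJs
  · exact Kerrr.not_fieldEqs_kerrrMass hm hl a
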